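/- **Conventions.** A linear space on a finite set $\mathcal P$ of points is given by a set $\mathcal L$ of subsets of $\mathcal P$ (lines) such that any two distinct points lie in exactly one line. It is nontrivial if it has at least two lines and every line has at least three points, and regular if all lines have the same size. $\mathrm{Aut}(\mathcal P,\mathcal L)$ is the group of permutations of $\mathcal P$ that preserve $\mathcal L$. A linear space $(\mathcal P,\mathcal L')$ is a refinement of $(\mathcal P,\mathcal L)$ if every line in $\mathcal L'$ is contained in a line in $\mathcal L$. A finite non-regular primitive permutation group is extremely primitive if a point stabiliser acts primitively on each of its nontrivial orbits. If $G\le\mathrm{Aut}(S)$, the pair $(S,G)$ is transverse if $|\ell\cap\Delta|\le 1$ for every line $\ell$, every point $u\in\ell$ and every orbit $\Delta$ of $G_u$. A permutation group $G$ on $\Omega$ has Property $(\star)$ if for all $u,v,w\in\Omega$ with $u\ne w$, $G_{uv}\le G_w$ implies $G_{uw}\le G_v$; then $\mathcal{LS}(G)$ is the structure on $\Omega$ whose lines are the sets $\Lambda_{uv}=\{w : G_{uv}\le G_w\}$, $u\neq v$. For a line $\ell$, $G_\ell^\ell$ is the permutation group induced on $\ell$ by the setwise stabiliser $G_\ell$.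 $D_{2q}$ is the dihedral group of order $2q$. For $Q=2^n$, the Witt–Bose–Shrikhande space $W(Q)$ has as points the subgroups of $\mathrm{PSL}_2(Q)$ isomorphic to $D_{2(Q+1)}$ and as lines the involutions of $\mathrm{PSL}_2(Q)$, a point being on a line if the subgroup contains the involution (so a line is identified with the set of its points). For a finite field $\mathbb F$ with $p^d$ elements, $\mathrm{GL}_1(p^d)$ and $\Gamma\mathrm L_1(p^d)$ are the groups of permutations $x\mapsto ax$ and $x\mapsto a\,\sigma(x)$ of $\mathbb F$, with $a\in\mathbb F^\times$ and $\sigma\in\mathrm{Aut}(\mathbb F)$. **Statement.** Let $q=65537=2^{16}+1$ and $G=\mathrm{PSL}_2(2^{16})$, which is a simple group. There are subgroups $D\cong D_{2q}$ of $G$, and there are subgroups $H\le\Gamma\mathrm L_1(2^{15})$ such that $|H\cap\mathrm{GL}_1(2^{15})|=1057$ and $H=C_{1057}\rtimes C_3$ with $C_{1057}=H\cap\mathrm{GL}_1(2^{15})$. Let $D\le G$ be any subgroup isomorphic to $D_{2q}$, and let $G$ act on the set $\Omega$ of cosets of $D$. Then: 1. $|\Omega|=2^{15}(2^{16}-1)$,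 and $G$ is faithful and extremely primitive on $\Omega$ and has Property $(\star)$. $S:=\mathcal{LS}(G)$ is a linear space with $G\le\mathrm{Aut}(S)$, $G$ is transitive on its lines, and $(S,G)$ is transverse. The map sending a point of $\Omega$ to its stabiliser in $G$ is an isomorphism from $S$ to $W(2^{16})$. 2. For every line $\ell$ of $S$, $|\ell|=2^{15}$ and $G_\ell^\ell\cong C_2^{15}$ is regular on $\ell$; moreover there is a bijection from $\ell$ to the field $\mathbb F$ of order $2^{15}$ that carries $G_\ell^\ell$ to the group $V$ of translations of $\mathbb F$. 3. Let $H$ be any subgroup as above and let $A=V\rtimes H\le\mathrm{A\Gamma L}_1(2^{15})$. Then $A$ has Property $(\star)$, and $T:=\mathcal{LS}(A)$ is a linear space on $\mathbb F$ with $V\le A\le\mathrm{Aut}(T)$, all of whose lines have $32$ points. 4. Let $\ell$ be any line of $S$, identify $\ell$ with $\mathbb F$ by any bijection as in 2, so that $T$ becomes a linear space on $\ell$, and let $R$ be the structure with point set $\Omega$ whose lines are the sets $t^g$, with $t$ a line of $T$ and $g\in G$. Then $R$ is a nontrivial regular linear space with $G\le\mathrm{Aut}(R)$; $R$ is a refinement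 of $S$ and $R\ne S$; and $R$ is not isomorphic to $W(2^n)$ for any $n\ge 1$. Every line of $R$ has $32$ points and every point is on exactly $1057q$ lines, that is, $R$ has parameters $(v,k,r)=(2^{15}(2^{16}-1),\,32,\,1057q)$. The pair $(R,G)$ is transverse; for every line $m$ of $R$ and every point $u\in m$ the orbit of $m$ under $G_u$ has size $q$; and for every point $u$ the group $G_u$ has exactly $1057$ orbits on the lines of $R$ through $u$. Finally, $|G|$ is smaller than the number of lines of $R$, and $G$ is not transitive on the lines of $R$. -/

import Mathlib

open scoped Pointwise MatrixGroups

/-! Linear spaces. A linear space on the point set `P` is given by its set of lines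
`L : Set (Set P)`. -/

/-- Each pair of distinct points is contained in exactly one line. -/
def IsLinearSpace {P : Type*} (L : Set (Set P)) : Prop :=
  ∀ u v : P, u ≠ v → ∃! l : Set P, l ∈ L ∧ u ∈ l ∧ v ∈ l

/-- A linear space is nontrivial if it has at least two lines and every line has at least three
points. -/
def IsNontrivialSpace {P : Type*} (L : Set (Set P)) : Prop :=
  L.Nontrivial ∧ ∀ l ∈ L, 3 ≤ l.encard

/-- `L'` is a refinement of `L`: every line of `L'` is contained in a line of `L`. -/
def IsRefinement {P : Type*} (L' L : Set (Set P)) : Prop :=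
  ∀ l' ∈ L', ∃ l ∈ L, l' ⊆ l

/-- The automorphism group: the permutations of the points that preserve the set of lines. -/
def autGroup {P : Type*} (L : Set (Set P)) : Subgroup (Equiv.Perm P) where
  carrier := {σ | ∀ l : Set P, σ '' l ∈ L ↔ l ∈ L}
  one_mem' := by intro l; simp
  mul_mem' := by
    intro a b ha hb l
    have h : (⇑(a * b)) '' l = a '' (b '' l) := by
      rw [Equiv.Perm.coe_mul, Set.image_comp]
    rw [h]
    exact (ha _).trans (hb l)
  inv_mem' := by
    intro a ha l
    have h : a '' ((⇑a⁻¹) '' l) = l := by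
      rw [← Set.image_comp, ← Equiv.Perm.coe_mul, mul_inv_cancel, Equiv.Perm.coe_one, Set.image_id]
    have h2 := ha ((⇑a⁻¹) '' l)
    rw [h] at h2
    exact h2.symm

/-- The group `G` acting on `P` acts by automorphisms of the space with line set `L`
(that is, `G ≤ Aut(L)` when the action is faithful). -/
def ActsOnSpace (G : Type*) [Group G] {P : Type*} [MulAction G P] (L : Set (Set P)) : Prop :=
  (MulAction.toPermHom G P).range ≤ autGroup L

/-- `G` is transitive on the set of lines `L`. -/
def IsLineTransitive (G : Type*) [Group G] {P : Type*} [MulAction G P] (L : Set (Set P)) : Prop :=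
  ∀ l ∈ L, ∀ l' ∈ L, ∃ g : G, g • l = l'

/-- For every flag `(u, l)` and every orbit `Δ` of `G_u`, the set `l ∩ Δ` has at most one point. -/
def IsTransverse (G : Type*) [Group G] {P : Type*} [MulAction G P] (L : Set (Set P)) : Prop :=
  ∀ l ∈ L, ∀ u ∈ l, ∀ x : P, (l ∩ MulAction.orbit (MulAction.stabilizer G u) x).Subsingleton

/-- Isomorphism of point-line structures: a bijection of the points carrying lines to lines
in both directions. -/
def IsSpaceIso {P P' : Type*} (L : Set (Set P)) (L' : Set (Set P')) (e : P ≃ P') : Prop :=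
  ∀ l : Set P, e '' l ∈ L' ↔ l ∈ L

/-! Permutation groups. -/

/-- An action is extremely primitive if it is finite, faithful, primitive and non-regular, and every
point stabiliser acts primitively on each of its orbits. (A group acts primitively on a one-point
orbit, so nothing is added by including the trivial orbits.) -/
def IsExtremelyPrimitive (G : Type*) [Group G] (P : Type*) [MulAction G P] : Prop :=
  Finite P ∧ FaithfulSMul G P ∧ MulAction.IsPreprimitive G P ∧
  (∀ u : P, MulAction.stabilizer G u ≠ ⊥) ∧
  ∀ u x : P, MulAction.IsPreprimitive (MulAction.stabilizer G u)
    (MulAction.orbit (MulAction.stabilizer G u) x)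

/-- The pointwise stabiliser `G_{uv}` of two points. -/
def pairStabilizer (G : Type*) [Group G] {P : Type*} [MulAction G P] (u v : P) : Subgroup G :=
  MulAction.stabilizer G u ⊓ MulAction.stabilizer G v

/-- Property (star): `G_{uv} ≤ G_w` implies `G_{uw} ≤ G_v` whenever `u ≠ w`. -/
def PropertyStar (G : Type*) [Group G] (P : Type*) [MulAction G P] : Prop :=
  ∀ u v w : P, u ≠ w → pairStabilizer G u v ≤ MulAction.stabilizer G w →
    pairStabilizer G u w ≤ MulAction.stabilizer G v

/-- The lines of `LS(G)`: the sets `Λ_{uv} = {w | G_{uv} ≤ G_w}` with `u ≠ v`. -/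
def lsLines (G : Type*) [Group G] (P : Type*) [MulAction G P] : Set (Set P) :=
  {l | ∃ u v : P, u ≠ v ∧ l = {w | pairStabilizer G u v ≤ MulAction.stabilizer G w}}

/-- The permutation group `G_l^l` induced on the set `l` by its setwise stabiliser `G_l`. -/
def inducedGroup (G : Type*) [Group G] {P : Type*} [MulAction G P] (l : Set P) :
    Subgroup (Equiv.Perm l) :=
  (MulAction.toPermHom (MulAction.stabilizer G l) l).range

/-- A permutation group is regular if it is transitive and all its point stabilisers are trivial. -/
def IsRegularPermGroup {X : Type*} (A : Subgroup (Equiv.Perm X)) : Prop :=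
  MulAction.IsPretransitive A X ∧ ∀ x : X, MulAction.stabilizer A x = ⊥

/-- Given a line set `TL` on (the points of) a line `l`, the set of all images `t^g`
with `t` in `TL` and `g` in `G`. -/
def constructionLines (G : Type*) [Group G] {P : Type*} [MulAction G P] (l : Set P)
    (TL : Set (Set l)) : Set (Set P) :=
  {m | ∃ t ∈ TL, ∃ g : G, m = g • (Subtype.val '' t : Set P)}

/-! One-dimensional (semi)linear groups over a field, as permutation groups of the field. -/

/-- `ΓL₁(F)`: the maps `x ↦ a σ(x)` with `a ≠ 0` and `σ` a field automorphism. -/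
def gammaL1 (F : Type*) [Field F] : Subgroup (Equiv.Perm F) where
  carrier := {f | ∃ (a : Fˣ) (σ : F ≃+* F), ∀ x, f x = a * σ x}
  one_mem' := ⟨1, RingEquiv.refl F, by simp⟩
  mul_mem' := by
    rintro f g ⟨a, σ, hf⟩ ⟨b, τ, hg⟩
    refine ⟨a * Units.map (σ : F →* F) b, τ.trans σ, fun x => ?_⟩
    simp [hf, hg, mul_assoc]
  inv_mem' := by
    rintro f ⟨a, σ, hf⟩
    refine ⟨Units.map (σ.symm : F →* F) a⁻¹, σ.symm, fun x => ?_⟩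
    rw [Equiv.Perm.inv_eq_iff_eq, hf]
    simp

/-- `GL₁(F)`: the maps `x ↦ a x` with `a ≠ 0`. -/
def gl1 (F : Type*) [Field F] : Subgroup (Equiv.Perm F) :=
  (MulAction.toPermHom Fˣ F).range

/-- The group of translations `x ↦ x + b`. -/
def translations (F : Type*) [Field F] : Subgroup (Equiv.Perm F) where
  carrier := {f | ∃ b : F, ∀ x, f x = x + b}
  one_mem' := ⟨0, by simp⟩
  mul_mem' := by
    rintro f g ⟨a, hf⟩ ⟨b, hg⟩
    exact ⟨b + a, fun x => by simp [hf, hg, add_assoc]⟩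
  inv_mem' := by
    rintro f ⟨a, hf⟩
    refine ⟨-a, fun x => ?_⟩
    rw [Equiv.Perm.inv_eq_iff_eq, hf]
    simp

/-- `H ≤ ΓL₁(F)` is an internal semidirect product `C_t ⋊ C_e` with `C_t = H ∩ GL₁(F)`: the subgroup
`H ∩ GL₁(F)` (which is normal in `H`, and cyclic because `F` is finite) has order `t` and a cyclic
complement of order `e` in `H`. -/
def IsSemilinearProduct {F : Type*} [Field F] (H : Subgroup (Equiv.Perm F)) (t e : ℕ) : Prop :=
  H ≤ gammaL1 F ∧ Nat.card (H ⊓ gl1 F : Subgroup (Equiv.Perm F)) = t ∧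
  ∃ E : Subgroup (Equiv.Perm F), IsCyclic E ∧ Nat.card E = e ∧
    (H ⊓ gl1 F) ⊓ E = ⊥ ∧ (H ⊓ gl1 F) ⊔ E = H

/-- The subgroup `A = V ⋊ H` of `AΓL₁(F)` generated by the translation group `V` and `H`. -/
def affineGroup {F : Type*} [Field F] (H : Subgroup (Equiv.Perm F)) : Subgroup (Equiv.Perm F) :=
  translations F ⊔ H

/-! The Witt–Bose–Shrikhande space over a field with `Q` elements (`Q` a power of two): points are
the subgroups of `PSL₂(Q)` isomorphic to the dihedral group of order `2(Q+1)`, lines are the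
involutions, and a point is on a line when the subgroup contains the involution. -/

/-- The points of the Witt–Bose–Shrikhande space. -/
abbrev WBSPoint (K : Type*) [Field K] : Type _ :=
  {D : Subgroup PSL(2, K) // Nonempty (D ≃* DihedralGroup (Nat.card K + 1))}

/-- The lines of the Witt–Bose–Shrikhande space, each given as its set of points. -/
def wbsLines (K : Type*) [Field K] : Set (Set (WBSPoint K)) :=
  {l | ∃ g : PSL(2, K), orderOf g = 2 ∧ l = {D | g ∈ D.1}}

/-!
The group `PSL₂(Q)`, for a power `Q` of two, is `SL₂(Q)`. When `q = Q + 1` is prime, the dihedral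
subgroups `D` of order `2q` are the normalisers of the tori generated by the elements of order `q`.
Two facts about `2 × 2` matrices govern the action on the cosets of `D`. The first is that the
elements commuting with a matrix `c` of order `q` are the `x + y c`, and
`(x + y c) ^ Q = x + y c⁻¹ = (x + y c)⁻¹`; so the torus is its own centraliser, and `D` is its own
normaliser (`HasEllipticTori.mem_iff`, `HasEllipticTori.mem_of_conj_eq`). The second is that two
matrices of order `q` are inverted by a common involution `t`: the conditions `tr t = 0`,
`tr (t c) = 0`, `tr (t c') = 0` are three linear equations in four unknowns, and a nonzero solution
is invertible since `c` has no eigenvector (`SL2CharTwo.exists_inverting`). Hence two distinct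
subgroups `D` meet in exactly one involution, that is, `G_{uv}` has order two for all `u ≠ v`
(`HasEllipticTori.exists_inf_eq_zpowers`).

Everything about `S = LS(G)` follows from this. Its lines are the fixed point sets of the
involutions, which is the description of the Witt–Bose–Shrikhande space. The centraliser of an
involution `t` is elementary abelian of order `Q` and acts transitively on the fixed points of `t`,
with kernel and point stabilisers `⟨t⟩`; so `G_l^l` is regular and elementary abelian of order
`Q / 2`. A suborbit other than `{u}` has prime length `q`, and a block of imprimitivity has size `1`
modulo `q`, which forces it to be trivial.

On the side of the field `F` of order `2 ^ 15`, the arithmetic `1057 = 1 + 32 + 32 ^ 2` shows that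
`H` can only be the group of the maps `x ↦ a x ^ (32 ^ i)` with `a` of norm one over the subfield of
order `32` (`IsSemilinearProduct.eq_normOneGroup`). As every nonzero `d` satisfies
`(d ^ 31) ^ 1057 = 1`, the stabiliser of two points `u`, `v` in `A` contains a map with fixed points
`u + s (v - u)`, `s ^ 32 = s`; so `T` is the affine space of dimension three over the subfield of
order `32` (`pairStabilizer_le_iff`).

Then `R` is a linear space because `T` is invariant under the group induced on a line of `S`, and
the stabiliser in `G_u` of a line through `u` has order two, as it has for `S`. The remaining
parameters come from counting. Finally, if `R` were isomorphic to `W(2 ^ n)`, all lines of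
`W(2 ^ n)` would have `32` points, and counting the pairs of an involution and a dihedral subgroup
containing it would show that the number of involutions is even. But a finite group of even order
has an odd number of involutions (`not_isSpaceIso_wbs`).
-/

/-! ### Matrices of determinant one in characteristic two -/

namespace SL2CharTwo

open Matrix

variable {K : Type*} [Field K]

theorem ext_entries {g h : SL(2, K)} (h00 : g 0 0 = h 0 0) (h01 : g 0 1 = h 0 1)
    (h10 : g 1 0 = h 1 0) (h11 : g 1 1 = h 1 1) : g = h := by
  ext i j
  fin_cases i <;> fin_cases j <;> assumption

theorem det_entries (g : SL(2, K)) : g 0 0 * g 1 1 - g 0 1 * g 1 0 = 1 := by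
  rw [← Matrix.det_fin_two, g.det_coe]

theorem mul_entries (g h : SL(2, K)) (i j : Fin 2) :
    (g * h) i j = g i 0 * h 0 j + g i 1 * h 1 j := by
  exact (Matrix.mul_apply ..).trans (Fin.sum_univ_two _)

@[simp] theorem one_00 : (1 : SL(2, K)) 0 0 = 1 := rfl
@[simp] theorem one_01 : (1 : SL(2, K)) 0 1 = 0 := rfl
@[simp] theorem one_10 : (1 : SL(2, K)) 1 0 = 0 := rfl
@[simp] theorem one_11 : (1 : SL(2, K)) 1 1 = 1 := rfl

@[simp] theorem inv_00 (g : SL(2, K)) : (g⁻¹ : SL(2, K)) 0 0 = g 1 1 :=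
  congrFun (congrFun (Matrix.adjugate_fin_two _) 0) 0
@[simp] theorem inv_01 (g : SL(2, K)) : (g⁻¹ : SL(2, K)) 0 1 = -g 0 1 :=
  congrFun (congrFun (Matrix.adjugate_fin_two _) 0) 1
@[simp] theorem inv_10 (g : SL(2, K)) : (g⁻¹ : SL(2, K)) 1 0 = -g 1 0 :=
  congrFun (congrFun (Matrix.adjugate_fin_two _) 1) 0
@[simp] theorem inv_11 (g : SL(2, K)) : (g⁻¹ : SL(2, K)) 1 1 = g 0 0 :=
  congrFun (congrFun (Matrix.adjugate_fin_two _) 1) 1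

/-- The element of `SL₂` with rows `(a, b)` and `(c, d)`. -/
def ofEntries (a b c d : K) (h : a * d - b * c = 1) : SL(2, K) :=
  ⟨!![a, b; c, d], by rw [Matrix.det_fin_two_of, h]⟩

section

variable (a b c d : K) (h : a * d - b * c = 1)

@[simp] theorem ofEntries_00 : ofEntries a b c d h 0 0 = a := rfl
@[simp] theorem ofEntries_01 : ofEntries a b c d h 0 1 = b := rfl
@[simp] theorem ofEntries_10 : ofEntries a b c d h 1 0 = c := rfl
@[simp] theorem ofEntries_11 : ofEntries a b c d h 1 1 = d := rfl

end

theorem commute_entries {g h : SL(2, K)} (hc : Commute g h) :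
    g 0 1 * h 1 0 = h 0 1 * g 1 0 ∧ g 0 1 * (h 0 0 - h 1 1) = h 0 1 * (g 0 0 - g 1 1) ∧
      g 1 0 * (h 0 0 - h 1 1) = h 1 0 * (g 0 0 - g 1 1) := by
  have e (i j : Fin 2) : (g * h) i j = (h * g) i j := by rw [hc.eq]
  have e00 := e 0 0
  have e01 := e 0 1
  have e10 := e 1 0
  simp only [mul_entries] at e00 e01 e10
  refine ⟨?_, ?_, ?_⟩
  · linear_combination e00
  · linear_combination -e01
  · linear_combination e10

theorem card_SL2 [Finite K] : Nat.card SL(2, K) = Nat.card K * (Nat.card K ^ 2 - 1) := by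
  classical
  have : Fintype K := Fintype.ofFinite K
  have h1 := Matrix.card_GL_field (𝔽 := K) 2
  have hdet := Subgroup.card_mul_index
    (Matrix.GeneralLinearGroup.det : GL (Fin 2) K →* Kˣ).ker
  rw [Subgroup.index_ker, MonoidHom.range_eq_top.2 Matrix.GeneralLinearGroup.det_surjective,
    Subgroup.card_top, h1, Fin.prod_univ_two] at hdet
  have hker : (SpecialLinearGroup.toGL : SL(2, K) →* GL (Fin 2) K).range =
      (Matrix.GeneralLinearGroup.det : GL (Fin 2) K →* Kˣ).ker := by
    ext g
    rw [MonoidHom.mem_range, MonoidHom.mem_ker, Units.ext_iff]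
    constructor
    · rintro ⟨x, rfl⟩
      exact x.2
    · intro hg
      exact ⟨⟨g.1, hg⟩, Units.ext rfl⟩
  rw [← hker, ← Nat.card_congr
    (MonoidHom.ofInjective (SpecialLinearGroup.toGL_injective (n := Fin 2) (R := K))).toEquiv,
    Nat.card_units] at hdet
  have hpos : 0 < Nat.card K - 1 := Nat.sub_pos_of_lt Finite.one_lt_card
  apply Nat.eq_of_mul_eq_mul_right hpos
  rw [hdet, ← Nat.card_eq_fintype_card]
  have : Nat.card K ^ 2 - Nat.card K = Nat.card K * (Nat.card K - 1) := by
    rw [Nat.mul_sub, mul_one, sq]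
  simp only [Fin.val_zero, Fin.val_one, pow_zero, pow_one, this]
  ring

variable [CharP K 2]

theorem sq_eq_one_iff_trace (g : SL(2, K)) : g ^ 2 = 1 ↔ g 0 0 + g 1 1 = 0 := by
  have hd := det_entries g
  have h2 : (2 : K) = 0 := CharTwo.two_eq_zero
  constructor
  · intro h
    have e (i j : Fin 2) : (g * g) i j = (1 : SL(2, K)) i j := by rw [← sq, h]
    have e00 := e 0 0
    have e11 := e 1 1
    simp only [mul_entries, one_00, one_11] at e00 e11
    have : (g 0 0 + g 1 1) ^ 2 = 0 := by
      linear_combination e00 + e11 + 2 * hd + 2 * h2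
    exact pow_eq_zero_iff (two_ne_zero) |>.1 this
  · intro h
    have h' : g 1 1 = g 0 0 := by linear_combination h - h2 * g 0 0
    rw [sq]
    rw [h'] at hd
    apply ext_entries <;> simp [mul_entries, h']
    · linear_combination hd + h2 * (g 0 1 * g 1 0)
    · linear_combination h2 * (g 0 1 * g 0 0)
    · linear_combination h2 * (g 1 0 * g 0 0)
    · linear_combination hd + h2 * (g 0 1 * g 1 0)

theorem entries_of_orderOf_eq_two {t : SL(2, K)} (ht : orderOf t = 2) :
    t 1 1 = t 0 0 ∧ (t 0 1 ≠ 0 ∨ t 1 0 ≠ 0) := by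
  have h2 : (2 : K) = 0 := CharTwo.two_eq_zero
  obtain ⟨h1, hne⟩ := (orderOf_eq_prime_iff).1 ht
  have htr := (sq_eq_one_iff_trace t).1 h1
  have h11 : t 1 1 = t 0 0 := by linear_combination htr - h2 * t 0 0
  refine ⟨h11, ?_⟩
  by_contra! hc
  apply hne
  have hd := det_entries t
  rw [h11, hc.1] at hd
  have h0 : t 0 0 = 1 := by
    have : (t 0 0 - 1) ^ 2 = 0 := by linear_combination hd + h2 * (1 - t 0 0)
    exact sub_eq_zero.1 (pow_eq_zero_iff (two_ne_zero) |>.1 this)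
  apply ext_entries <;> simp [h11, h0, hc.1, hc.2]

/-- The centraliser of an involution of `SL₂` in characteristic two has exponent two. -/
theorem sq_eq_one_of_commute {t g : SL(2, K)} (ht : orderOf t = 2) (hg : Commute g t) :
    g ^ 2 = 1 := by
  have h2 : (2 : K) = 0 := CharTwo.two_eq_zero
  obtain ⟨h11, hne⟩ := entries_of_orderOf_eq_two ht
  obtain ⟨-, h01, h10⟩ := commute_entries hg
  rw [sq_eq_one_iff_trace]
  rw [h11, sub_self, mul_zero] at h01 h10
  have : g 0 0 - g 1 1 = 0 := by
    rcases hne with h | h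
    · exact (mul_eq_zero.1 h01.symm).resolve_left h
    · exact (mul_eq_zero.1 h10.symm).resolve_left h
  linear_combination this + h2 * g 1 1

/-- The elements commuting with an involution `t` are the matrices `1 + s (t - 1)`. -/
theorem card_centralizer {t : SL(2, K)} (ht : orderOf t = 2) :
    Nat.card (Subgroup.centralizer {t}) = Nat.card K := by
  have h2 : (2 : K) = 0 := CharTwo.two_eq_zero
  obtain ⟨h11, hne⟩ := entries_of_orderOf_eq_two ht
  have hd := det_entries t
  rw [h11] at hd
  let m (s : K) : SL(2, K) :=
    ofEntries (1 + s * (t 0 0 - 1)) (s * t 0 1) (s * t 1 0) (1 + s * (t 0 0 - 1)) (by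
      linear_combination s ^ 2 * hd + h2 * (s * (t 0 0 - 1) + s ^ 2 * (1 - t 0 0)))
  have hm (s : K) : m s ∈ Subgroup.centralizer {t} := by
    rw [Subgroup.mem_centralizer_singleton_iff]
    apply ext_entries <;> simp only [mul_entries, h11, m, ofEntries_00, ofEntries_01,
      ofEntries_10, ofEntries_11] <;> ring
  refine (Nat.card_eq_of_bijective (fun s : K => (⟨m s, hm s⟩ : Subgroup.centralizer {t}))
    ⟨fun s s' h => ?_, fun g => ?_⟩).symm
  · have h' : m s = m s' := congrArg Subtype.val h
    have e01 : s * t 0 1 = s' * t 0 1 := congrArg (fun g : SL(2, K) => g 0 1) h'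
    have e10 : s * t 1 0 = s' * t 1 0 := congrArg (fun g : SL(2, K) => g 1 0) h'
    rcases hne with h | h
    · exact mul_right_cancel₀ h e01
    · exact mul_right_cancel₀ h e10
  · obtain ⟨g, hg⟩ := g
    rw [Subgroup.mem_centralizer_singleton_iff] at hg
    have hgd := det_entries g
    have hg2 := (sq_eq_one_iff_trace g).1 (sq_eq_one_of_commute ht hg)
    have hg11 : g 1 1 = g 0 0 := by linear_combination hg2 - h2 * g 0 0
    rw [hg11] at hgd
    obtain ⟨hbe, -, -⟩ := commute_entries hg
    obtain ⟨s, hs1, hs2⟩ : ∃ s, g 0 1 = s * t 0 1 ∧ g 1 0 = s * t 1 0 := by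
      rcases hne with h | h
      · refine ⟨g 0 1 / t 0 1, by field_simp, ?_⟩
        field_simp
        linear_combination -hbe
      · refine ⟨g 1 0 / t 1 0, ?_, by field_simp⟩
        field_simp
        linear_combination hbe
    have hs0 : g 0 0 = 1 + s * (t 0 0 - 1) := by
      have : (g 0 0 - (1 + s * (t 0 0 - 1))) ^ 2 = 0 := by
        rw [hs1, hs2] at hgd
        linear_combination hgd - s ^ 2 * hd + h2 * (1 - g 0 0 - g 0 0 * s * (t 0 0 - 1) +
          s * (t 0 0 - 1) + s ^ 2 * t 0 0 * (t 0 0 - 1))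
      exact sub_eq_zero.1 (pow_eq_zero_iff (two_ne_zero) |>.1 this)
    refine ⟨s, Subtype.ext (ext_entries ?_ ?_ ?_ ?_)⟩ <;> simp [m, hs0, hs1, hs2, hg11]

variable [Finite K]

theorem exists_sq_mul_eq_one {a : K} (ha : a ≠ 0) : ∃ s : K, s ^ 2 * a = 1 := by
  have : Fintype K := Fintype.ofFinite K
  obtain ⟨s, hs⟩ := FiniteField.isSquare_of_char_two
    (CharP.ringChar_of_prime_eq_zero Nat.prime_two CharTwo.two_eq_zero : ringChar K = 2) a⁻¹
  exact ⟨s, by rw [sq, ← hs, inv_mul_cancel₀ ha]⟩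

/-- An involution `t` is carried to a fixed unipotent matrix by the basis `(t - 1) v, v`, for a
multiple `v` of a standard basis vector that `t` does not fix; the multiple makes the determinant
equal to one. -/
theorem isConj_of_orderOf_eq_two {t t' : SL(2, K)} (ht : orderOf t = 2) (ht' : orderOf t' = 2) :
    IsConj t t' := by
  have h2 : (2 : K) = 0 := CharTwo.two_eq_zero
  let u : SL(2, K) := ofEntries 1 1 0 1 (by ring)
  have key : ∀ t : SL(2, K), orderOf t = 2 → IsConj u t := by
    intro t ht
    obtain ⟨h11, hne⟩ := entries_of_orderOf_eq_two ht
    have hd := det_entries t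
    rw [h11] at hd
    rw [isConj_iff]
    by_cases hz : t 1 0 = 0
    · have hy : t 0 1 ≠ 0 := by tauto
      rw [hz] at hd
      have h0 : t 0 0 = 1 := by
        have : (t 0 0 - 1) ^ 2 = 0 := by linear_combination hd + h2 * (1 - t 0 0)
        exact sub_eq_zero.1 (pow_eq_zero_iff (two_ne_zero) |>.1 this)
      obtain ⟨s, hs⟩ := exists_sq_mul_eq_one hy
      refine ⟨ofEntries (s * t 0 1) 0 0 s (by linear_combination hs), ?_⟩
      rw [mul_inv_eq_iff_eq_mul]
      apply ext_entries <;> simp [mul_entries, u, h11, h0, hz] <;> ring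
    · obtain ⟨s, hs⟩ := exists_sq_mul_eq_one hz
      refine ⟨ofEntries (s * (t 0 0 - 1)) s (s * t 1 0) 0
        (by linear_combination hs - h2 * (s ^ 2 * t 1 0)), ?_⟩
      rw [mul_inv_eq_iff_eq_mul]
      apply ext_entries <;> simp only [mul_entries, u, h11] <;> simp
      · linear_combination (-s) * hd + h2 * s * (t 0 0 - 1 - t 0 1 * t 1 0)
      · ring
      · linear_combination -h2 * s * t 1 0 * (t 0 0 - 1)
      · ring
  exact (key t ht).symm.trans (key t' ht')

/-! ### Matrices of order `Q + 1` -/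

section Elliptic

variable {c : SL(2, K)} (hc : orderOf c = Nat.card K + 1)

include hc

theorem trace_ne_zero : c 0 0 + c 1 1 ≠ 0 := by
  rw [Ne, ← sq_eq_one_iff_trace]
  intro h
  have h1 := Nat.le_of_dvd two_pos (hc ▸ orderOf_dvd_of_pow_eq_one h)
  have := Finite.one_lt_card (α := K)
  omega

/-- An element of order `Q + 1` has no eigenvector over the field with `Q` elements: the eigenvalue
would have order dividing both `Q + 1` and `Q - 1`, so would be `1`, and the trace would vanish. -/
theorem eq_zero_of_eigenvector {v : Fin 2 → K} {μ : K}
    (hv : (c : Matrix (Fin 2) (Fin 2) K) *ᵥ v = μ • v) :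
    v = 0 := by
  have h2 : (2 : K) = 0 := CharTwo.two_eq_zero
  have : Fintype K := Fintype.ofFinite K
  by_contra hv0
  have hpow (n : ℕ) : ((c : Matrix (Fin 2) (Fin 2) K) ^ n) *ᵥ v = μ ^ n • v := by
    induction n with
    | zero => simp
    | succ n ih =>
      rw [pow_succ, ← Matrix.mulVec_mulVec, hv, Matrix.mulVec_smul, ih, smul_smul, pow_succ']
  have h1 : μ ^ (Nat.card K + 1) = 1 := by
    have h := hpow (Nat.card K + 1)
    have h1 : (c : Matrix (Fin 2) (Fin 2) K) ^ orderOf c = 1 :=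
      congrArg Subtype.val (pow_orderOf_eq_one c)
    rw [← hc, h1, Matrix.one_mulVec] at h
    have h' : (μ ^ orderOf c - 1) • v = 0 := by rw [sub_smul, ← h, one_smul, sub_self]
    rw [← hc]
    exact sub_eq_zero.1 ((smul_eq_zero.1 h').resolve_right hv0)
  have hμ : μ = 1 := by
    rw [pow_succ, Nat.card_eq_fintype_card, FiniteField.pow_card] at h1
    have : (μ - 1) ^ 2 = 0 := by linear_combination h1 + h2 * (1 - μ)
    exact sub_eq_zero.1 (pow_eq_zero_iff (two_ne_zero) |>.1 this)
  subst hμ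
  rw [one_smul] at hv
  have e0 := congrFun hv 0
  have e1 := congrFun hv 1
  simp only [Matrix.mulVec, dotProduct, Fin.sum_univ_two] at e0 e1
  have hd := det_entries c
  apply trace_ne_zero hc
  by_contra htr
  apply hv0
  have k0 : (c 0 0 + c 1 1) * v 0 = 0 := by
    linear_combination (-(c 1 1 - 1)) * e0 + c 0 1 * e1 + hd * v 0 + h2 * v 0
  have k1 : (c 0 0 + c 1 1) * v 1 = 0 := by
    linear_combination (-(c 0 0 - 1)) * e1 + c 1 0 * e0 + hd * v 1 + h2 * v 1
  ext i
  fin_cases i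
  · exact (mul_eq_zero.1 k0).resolve_left htr
  · exact (mul_eq_zero.1 k1).resolve_left htr

/-- The nonzero matrices `t` of trace zero with `tr (t c) = 0` are invertible: otherwise `t` is
nilpotent, and its image is spanned by an eigenvector of `c`. -/
theorem det_ne_zero_of_trace_mul {x y z : K} (h0 : ¬ (x = 0 ∧ y = 0 ∧ z = 0))
    (h : x * (c 0 0 + c 1 1) + y * c 1 0 + z * c 0 1 = 0) : x ^ 2 + y * z ≠ 0 := by
  have h2 : (2 : K) = 0 := CharTwo.two_eq_zero
  have : Fintype K := Fintype.ofFinite K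
  intro hd
  have hsq (w : K) : ∃ p, w = p * p := FiniteField.isSquare_of_char_two
    (CharP.ringChar_of_prime_eq_zero Nat.prime_two CharTwo.two_eq_zero : ringChar K = 2) w
  obtain ⟨p, rfl⟩ := hsq y
  obtain ⟨r, rfl⟩ := hsq z
  obtain rfl : x = p * r := by
    have : (x - p * r) ^ 2 = 0 := by linear_combination hd - h2 * x * p * r
    exact sub_eq_zero.1 (pow_eq_zero_iff (two_ne_zero) |>.1 this)
  by_cases hp : p = 0
  · have hr : r ≠ 0 := by rintro rfl; simp [hp] at h0
    subst hp
    have hb : c 0 1 = 0 := by simpa [hr] using h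
    have := eq_zero_of_eigenvector hc (v := ![0, r]) (μ := c 1 1) (by
      ext i; fin_cases i <;> simp [Matrix.mulVec, dotProduct, hb])
    exact hr (congrFun this 1)
  · have := eq_zero_of_eigenvector hc (v := ![p, r]) (μ := (c 0 0 * p + c 0 1 * r) / p) (by
      ext i; fin_cases i <;> simp [Matrix.mulVec, dotProduct, Fin.sum_univ_two]
      · field_simp
      · field_simp
        linear_combination h - h2 * (p * r * c 0 0 + r * r * c 0 1))
    exact hp (congrFun this 0)

theorem exists_inverting (c' : SL(2, K)) :
    ∃ t : SL(2, K), orderOf t = 2 ∧ t * c * t⁻¹ = c⁻¹ ∧ t * c' * t⁻¹ = c'⁻¹ := by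
  have h2 : (2 : K) = 0 := CharTwo.two_eq_zero
  obtain ⟨v, hv0, hv⟩ := Matrix.exists_mulVec_eq_zero_iff.2
    (show (!![c 0 0 + c 1 1, c 1 0, c 0 1; c' 0 0 + c' 1 1, c' 1 0, c' 0 1; 0, 0, 0]).det = 0 by
      rw [Matrix.det_fin_three]; simp)
  have e0 := congrFun hv 0
  have e1 := congrFun hv 1
  simp [Matrix.mulVec, dotProduct, Fin.sum_univ_three] at e0 e1
  have hv' : ¬ (v 0 = 0 ∧ v 1 = 0 ∧ v 2 = 0) := by
    rintro ⟨h0, h1, h2⟩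
    apply hv0
    ext i
    fin_cases i <;> assumption
  have hne := det_ne_zero_of_trace_mul hc (x := v 0) (y := v 1) (z := v 2) hv'
    (by linear_combination e0)
  obtain ⟨s, hs⟩ := exists_sq_mul_eq_one hne
  let t := ofEntries (s * v 0) (s * v 1) (s * v 2) (s * v 0)
    (by linear_combination hs - h2 * (s * v 1 * s * v 2))
  have ht2 : t ^ 2 = 1 := by
    rw [sq_eq_one_iff_trace]
    simp only [t, ofEntries_00, ofEntries_11]
    linear_combination h2 * (s * v 0)
  have hinv (d : SL(2, K)) (hd : (d 0 0 + d 1 1) * v 0 + d 1 0 * v 1 + d 0 1 * v 2 = 0) :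
      t * d * t⁻¹ = d⁻¹ := by
    have h : (t * d) ^ 2 = 1 := by
      rw [sq_eq_one_iff_trace]
      simp only [t, mul_entries, ofEntries_00, ofEntries_11, ofEntries_01, ofEntries_10]
      linear_combination s * hd
    have ht' : t⁻¹ = t := by rw [inv_eq_iff_mul_eq_one, ← sq, ht2]
    rw [ht', eq_inv_iff_mul_eq_one, mul_assoc _ t, ← sq, h]
  refine ⟨t, orderOf_eq_prime ht2 fun h => ?_, hinv c e0, hinv c' e1⟩
  have h3 := hinv c e0
  rw [h, inv_one, mul_one, one_mul, eq_inv_iff_mul_eq_one, ← sq, sq_eq_one_iff_trace] at h3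
  exact trace_ne_zero hc h3

/-- The matrices commuting with `c` are the polynomials in `c`. -/
theorem exists_add_mul_of_commute {g : SL(2, K)} (hg : Commute g c) :
    ∃ x y : K, g 0 0 = x + y * c 0 0 ∧ g 0 1 = y * c 0 1 ∧ g 1 0 = y * c 1 0 ∧
      g 1 1 = x + y * c 1 1 := by
  have h2 : (2 : K) = 0 := CharTwo.two_eq_zero
  obtain ⟨h1, h3, h4⟩ := commute_entries hg
  by_cases hb : c 0 1 = 0
  · by_cases he : c 1 0 = 0
    · have hne : c 0 0 - c 1 1 ≠ 0 := by
        intro h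
        apply trace_ne_zero hc
        linear_combination h + h2 * c 1 1
      simp only [hb, he, zero_mul, mul_eq_zero, hne, or_false] at h3 h4
      refine ⟨g 0 0 - (g 0 0 - g 1 1) / (c 0 0 - c 1 1) * c 0 0,
        (g 0 0 - g 1 1) / (c 0 0 - c 1 1), ?_, ?_, ?_, ?_⟩
      · ring
      · rw [hb, h3, mul_zero]
      · rw [he, h4, mul_zero]
      · field_simp
        ring
    · refine ⟨g 0 0 - g 1 0 / c 1 0 * c 0 0, g 1 0 / c 1 0, ?_, ?_, ?_, ?_⟩
      · ring
      · field_simp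
        linear_combination h1
      · field_simp
      · field_simp
        linear_combination h4
  · refine ⟨g 0 0 - g 0 1 / c 0 1 * c 0 0, g 0 1 / c 0 1, ?_, ?_, ?_, ?_⟩
    · ring
    · field_simp
    · field_simp
      linear_combination -h1
    · field_simp
      linear_combination h3
/-- A conjugate of `c` commuting with `c` is `x + y c` with the trace and determinant of `c`, which
leaves `c` and `tr c + c = c⁻¹`. -/
theorem eq_or_eq_inv_of_commute {g : SL(2, K)} (hg : Commute (g * c * g⁻¹) c) :
    g * c * g⁻¹ = c ∨ g * c * g⁻¹ = c⁻¹ := by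
  have h2 : (2 : K) = 0 := CharTwo.two_eq_zero
  have htr : (g * c * g⁻¹) 0 0 + (g * c * g⁻¹) 1 1 = c 0 0 + c 1 1 := by
    simp only [mul_entries, inv_00, inv_01, inv_10, inv_11]
    linear_combination (c 0 0 + c 1 1) * det_entries g
  generalize g * c * g⁻¹ = d at hg htr ⊢
  have hd := det_entries d
  have hdc := det_entries c
  obtain ⟨x, y, k00, k01, k10, k11⟩ := exists_add_mul_of_commute hc hg
  have hne := trace_ne_zero hc
  have hy : y = 1 := by
    apply mul_right_cancel₀ hne
    linear_combination htr - k00 - k11 - h2 * x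
  subst hy
  have hx : x * (x + (c 0 0 + c 1 1)) = 0 := by
    rw [k00, k01, k10, k11] at hd
    linear_combination hd - hdc
  rcases mul_eq_zero.1 hx with rfl | hx
  · left
    apply ext_entries <;> simp [k00, k01, k10, k11]
  · right
    apply ext_entries <;> simp only [k00, k01, k10, k11, inv_00, inv_01, inv_10, inv_11]
    · linear_combination hx - h2 * c 1 1
    · linear_combination h2 * c 0 1
    · linear_combination h2 * c 1 0
    · linear_combination hx - h2 * c 0 0

/-- In the commutative algebra `K[c]` of characteristic two, `(x + y c) ^ Q = x + y c⁻¹`, and this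
is the adjugate of `x + y c`. -/
theorem pow_eq_one_of_commute {g : SL(2, K)} (hg : Commute g c) :
    g ^ (Nat.card K + 1) = 1 := by
  have h2 : (2 : K) = 0 := CharTwo.two_eq_zero
  have : Fintype K := Fintype.ofFinite K
  obtain ⟨x, y, k00, k01, k10, k11⟩ := exists_add_mul_of_commute hc hg
  obtain ⟨n, hn, hcard⟩ := FiniteField.card K 2
  have hcp : (c : Matrix (Fin 2) (Fin 2) K) ^ Nat.card K = (c⁻¹ : SL(2, K)) := by
    have : c ^ Nat.card K = c⁻¹ := by
      rw [eq_inv_iff_mul_eq_one, ← pow_succ, ← hc, pow_orderOf_eq_one]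
    exact congrArg Subtype.val this
  have hgm : (g : Matrix (Fin 2) (Fin 2) K) =
      x • (1 : Matrix (Fin 2) (Fin 2) K) + y • (c : Matrix (Fin 2) (Fin 2) K) := by
    ext i j
    fin_cases i <;> fin_cases j <;> simp [k00, k01, k10, k11]
  have hgp : (g : Matrix (Fin 2) (Fin 2) K) ^ Nat.card K =
      x • (1 : Matrix (Fin 2) (Fin 2) K) + y • ((c⁻¹ : SL(2, K)) : Matrix (Fin 2) (Fin 2) K) := by
    rw [← hcp, hgm, Nat.card_eq_fintype_card, hcard, add_pow_char_pow_of_commute, smul_pow,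
      smul_pow, one_pow, ← hcard, FiniteField.pow_card, FiniteField.pow_card]
    exact ((Commute.one_left _).smul_left _).smul_right _
  have hgi : g ^ Nat.card K = g⁻¹ := by
    have hgp' (i j : Fin 2) : (g ^ Nat.card K) i j = (x • (1 : Matrix (Fin 2) (Fin 2) K) +
        y • ((c⁻¹ : SL(2, K)) : Matrix (Fin 2) (Fin 2) K)) i j := congrFun (congrFun hgp i) j
    apply ext_entries <;> rw [hgp'] <;>
      simp only [Matrix.add_apply, Matrix.smul_apply, smul_eq_mul, inv_00, inv_01, inv_10, inv_11,
        k00, k01, k10, k11] <;> simp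
  rw [pow_succ, hgi, inv_mul_cancel]

end Elliptic

end SL2CharTwo

/-! ### The properties of `PSL₂(Q)` and of dihedral groups -/

/-- The properties of `SL₂` over a finite field of characteristic two with `Q` elements that the
argument uses: the order, the involutions with their centralisers, and the subgroups of order
`Q + 1` generated by a single element (the elliptic tori). They are invariant under isomorphism, and
thus pass to `PSL₂`. -/
structure HasEllipticTori (G : Type*) [Group G] (Q : ℕ) : Prop where
  card_eq : Nat.card G = Q * (Q ^ 2 - 1)
  isConj_of_orderOf_eq_two {s t : G} : orderOf s = 2 → orderOf t = 2 → IsConj s t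
  card_centralizer {t : G} : orderOf t = 2 → Nat.card (Subgroup.centralizer {t}) = Q
  sq_eq_one_of_commute {t g : G} : orderOf t = 2 → Commute g t → g ^ 2 = 1
  pow_eq_one_of_commute {c g : G} : orderOf c = Q + 1 → Commute g c → g ^ (Q + 1) = 1
  eq_or_eq_inv_of_commute {c g : G} : orderOf c = Q + 1 → Commute (g * c * g⁻¹) c →
    g * c * g⁻¹ = c ∨ g * c * g⁻¹ = c⁻¹
  exists_inverting {c c' : G} : orderOf c = Q + 1 → orderOf c' = Q + 1 →
    ∃ t : G, orderOf t = 2 ∧ t * c * t⁻¹ = c⁻¹ ∧ t * c' * t⁻¹ = c'⁻¹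

namespace HasEllipticTori

theorem specialLinearGroup (K : Type*) [Field K] [Finite K] [CharP K 2] :
    HasEllipticTori SL(2, K) (Nat.card K) where
  card_eq := SL2CharTwo.card_SL2
  isConj_of_orderOf_eq_two := SL2CharTwo.isConj_of_orderOf_eq_two
  card_centralizer := SL2CharTwo.card_centralizer
  sq_eq_one_of_commute := SL2CharTwo.sq_eq_one_of_commute
  pow_eq_one_of_commute hc := SL2CharTwo.pow_eq_one_of_commute hc
  eq_or_eq_inv_of_commute hc := SL2CharTwo.eq_or_eq_inv_of_commute hc
  exists_inverting hc _ := SL2CharTwo.exists_inverting hc _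

theorem of_mulEquiv {G G' : Type*} [Group G] [Group G'] {Q : ℕ} (h : HasEllipticTori G Q)
    (e : G' ≃* G) : HasEllipticTori G' Q where
  card_eq := (Nat.card_congr e.toEquiv).trans h.card_eq
  isConj_of_orderOf_eq_two {s t} hs ht := by
    have := h.isConj_of_orderOf_eq_two (s := e s) (t := e t) (by simpa) (by simpa)
    simpa using e.symm.toMonoidHom.map_isConj this
  card_centralizer {t} ht := by
    rw [← h.card_centralizer (t := e t) (by simpa)]
    refine Nat.card_congr (e.toEquiv.subtypeEquiv fun g => ?_)
    simp [Subgroup.mem_centralizer_singleton_iff, ← map_mul]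
  sq_eq_one_of_commute {t g} ht hg := by
    have := h.sq_eq_one_of_commute (t := e t) (g := e g) (by simpa) (hg.map e)
    simpa [← map_pow] using this
  pow_eq_one_of_commute {c g} ht hg := by
    have := h.pow_eq_one_of_commute (c := e c) (g := e g) (by simpa) (hg.map e)
    simpa [← map_pow] using this
  eq_or_eq_inv_of_commute {c g} ht hg := by
    have := h.eq_or_eq_inv_of_commute (c := e c) (g := e g) (by simpa)
      (by simpa using hg.map e)
    simpa only [← map_mul, ← map_inv, e.injective.eq_iff] using this
  exists_inverting {c c'} hc hc' := by
    obtain ⟨t, ht, h1, h2⟩ := h.exists_inverting (c := e c) (c' := e c') (by simpa) (by simpa)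
    refine ⟨e.symm t, by simpa, e.injective ?_, e.injective ?_⟩ <;> simpa

theorem projectiveSpecialLinearGroup (K : Type*) [Field K] [Finite K] [CharP K 2] :
    HasEllipticTori PSL(2, K) (Nat.card K) := by
  have hbot : Subgroup.center SL(2, K) = ⊥ := by
    rw [eq_bot_iff]
    intro g hg
    obtain ⟨r, hr, hg'⟩ := Matrix.SpecialLinearGroup.mem_center_iff.1 hg
    have h1 : r = 1 := by
      have h2 : (2 : K) = 0 := CharTwo.two_eq_zero
      have : (r - 1) ^ 2 = 0 := by
        rw [Fintype.card_fin] at hr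
        linear_combination hr + h2 * (1 - r)
      exact sub_eq_zero.1 (pow_eq_zero_iff two_ne_zero |>.1 this)
    rw [h1, map_one] at hg'
    exact Subgroup.mem_bot.2 (Subtype.ext hg'.symm)
  exact (specialLinearGroup K).of_mulEquiv
    ((QuotientGroup.quotientMulEquivOfEq hbot).trans QuotientGroup.quotientBot)

end HasEllipticTori

namespace DihedralGroup

variable {n : ℕ}

theorem conj_r_mem (x : DihedralGroup n) (i : ZMod n) :
    x * r i * x⁻¹ = r i ∨ x * r i * x⁻¹ = (r i)⁻¹ := by
  rcases x with j | j
  · left; simp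
  · right; simp

theorem exists_eq_sr_of_orderOf_eq_two (hn : Odd n) {x : DihedralGroup n} (hx : orderOf x = 2) :
    ∃ i, x = sr i := by
  rcases x with i | i
  · exfalso
    have : NeZero n := ⟨hn.pos.ne'⟩
    have h : r i ^ n = (1 : DihedralGroup n) := by simp [r_pow]
    have := (Nat.coprime_two_left.2 hn).eq_one_of_dvd (hx ▸ orderOf_dvd_of_pow_eq_one h)
    omega
  · exact ⟨i, rfl⟩

theorem isConj_of_orderOf_eq_two (hn : Odd n) {x y : DihedralGroup n} (hx : orderOf x = 2)
    (hy : orderOf y = 2) : IsConj x y := by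
  obtain ⟨i, rfl⟩ := exists_eq_sr_of_orderOf_eq_two hn hx
  obtain ⟨j, rfl⟩ := exists_eq_sr_of_orderOf_eq_two hn hy
  obtain ⟨u, hu⟩ := (ZMod.isUnit_iff_coprime 2 n).2 (Nat.coprime_two_left.2 hn)
  have h2 : (2 : ZMod n) * ↑u⁻¹ = 1 := by
    have := u.mul_inv
    rwa [hu] at this
  rw [isConj_iff]
  refine ⟨r ((i - j) * ↑u⁻¹), ?_⟩
  simp only [inv_r, r_mul_sr, sr_mul_r, sr.injEq]
  linear_combination (j - i) * h2

theorem eq_of_commute (hn : Odd n) {x t : DihedralGroup n} (ht : orderOf t = 2)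
    (hx : Commute x t) : x = 1 ∨ x = t := by
  obtain ⟨i, rfl⟩ := exists_eq_sr_of_orderOf_eq_two hn ht
  obtain ⟨u, hu⟩ := (ZMod.isUnit_iff_coprime 2 n).2 (Nat.coprime_two_left.2 hn)
  have h2 : (2 : ZMod n) * ↑u⁻¹ = 1 := by
    have := u.mul_inv
    rwa [hu] at this
  rcases x with j | j
  · left
    have h : i - j = i + j := by simpa [Commute, SemiconjBy] using hx
    rw [one_def]
    congr 1
    linear_combination (-(↑u⁻¹ : ZMod n)) * h - j * h2
  · right
    have h : i - j = j - i := by simpa [Commute, SemiconjBy] using hx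
    congr 1
    linear_combination (-(↑u⁻¹ : ZMod n)) * h + (i - j) * h2

theorem orderOf_r_of_prime (hn : n.Prime) {i : ZMod n} (hi : r i ≠ 1) : orderOf (r i) = n := by
  have : Fact n.Prime := ⟨hn⟩
  refine orderOf_eq_prime ?_ hi
  simp [r_pow]

theorem exists_eq_r_of_orderOf_eq (hn : n ≠ 2) {x : DihedralGroup n} (hx : orderOf x = n) :
    ∃ i, x = r i := by
  rcases x with i | i
  · exact ⟨i, rfl⟩
  · exact absurd (hx.symm.trans (orderOf_sr i)) hn

/-- An element `c` of order `n ≥ 3` and an involution that inverts it generate a dihedral group of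
order `2 n`. -/
theorem exists_hom {G : Type*} [Group G] {c t : G} (hn : 2 < n) (hc : orderOf c = n)
    (ht : orderOf t = 2) (h : t * c * t⁻¹ = c⁻¹) :
    ∃ f : DihedralGroup n →* G, Function.Injective f := by
  have hcn : c ^ n = 1 := hc ▸ pow_orderOf_eq_one c
  let ρ : ZMod n →+ Additive G := ZMod.lift n ⟨zmultiplesHom (Additive G) (Additive.ofMul c), by
    simp [← ofMul_pow, hcn]⟩
  let σ (i : ZMod n) : G := (ρ i).toMul
  have hσ (i j : ZMod n) : σ (i + j) = σ i * σ j := by simp [σ]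
  have hσ0 : σ 0 = 1 := by simp [σ]
  have hσk (k : ℤ) : σ (k : ZMod n) = c ^ k := by simp [σ, ρ]
  have ht1 : t * t = 1 := by rw [← sq, ← ht, pow_orderOf_eq_one]
  have hti : t⁻¹ = t := inv_eq_of_mul_eq_one_left ht1
  have hσt (i : ZMod n) : σ i * t = t * σ (-i) := by
    obtain ⟨k, rfl⟩ := ZMod.intCast_surjective i
    rw [← Int.cast_neg, hσk, hσk, zpow_neg, ← inv_zpow, ← h, conj_zpow, hti]
    simp [← mul_assoc, ht1]
  let f : DihedralGroup n →* G :=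
    { toFun := fun x => match x with
        | r i => σ i
        | sr i => t * σ i
      map_one' := hσ0
      map_mul' := by
        rintro (i | i) (j | j)
        · simp [hσ]
        · simp only [r_mul_sr, ← mul_assoc, hσt]
          rw [mul_assoc, ← hσ, neg_add_eq_sub]
        · simp [hσ, mul_assoc]
        · simp only [sr_mul_sr]
          rw [mul_assoc, ← mul_assoc (σ i), hσt, mul_assoc, ← hσ, neg_add_eq_sub, ← mul_assoc, ht1,
            one_mul] }
  refine ⟨f, (injective_iff_map_eq_one f).2 ?_⟩
  rintro (i | i) hi
  · obtain ⟨k, rfl⟩ := ZMod.intCast_surjective i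
    have hi : c ^ k = 1 := (hσk k).symm.trans hi
    rw [← orderOf_dvd_iff_zpow_eq_one, hc] at hi
    rw [(ZMod.intCast_zmod_eq_zero_iff_dvd k n).2 hi, r_zero]
  · exfalso
    obtain ⟨k, rfl⟩ := ZMod.intCast_surjective i
    have hi : t * c ^ k = 1 := (congrArg (t * ·) (hσk k)).symm.trans hi
    have htc : t = c ^ (-k) := by rw [zpow_neg, eq_inv_iff_mul_eq_one, hi]
    have hcomm : t * c * t⁻¹ = c := by
      rw [mul_inv_eq_iff_eq_mul, htc, ← zpow_add_one, ← zpow_one_add, add_comm]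
    have : c ^ 2 = 1 := by rw [sq, ← eq_inv_iff_mul_eq_one, ← h, hcomm]
    have := Nat.le_of_dvd two_pos (hc ▸ orderOf_dvd_of_pow_eq_one this)
    omega

end DihedralGroup

/-! ### Dihedral subgroups of order `2 (Q + 1)` -/

theorem card_eq_of_forall_pow_eq {G : Type*} [Group G] [Finite G] {p : ℕ} (hp : p.Prime)
    (h : ∀ g : G, g ^ p = 1) (h2 : ¬ p ^ 2 ∣ Nat.card G) : Nat.card G ∣ p := by
  have : Fact p.Prime := ⟨hp⟩
  obtain ⟨k, hk⟩ := IsPGroup.iff_card.1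
    (fun g => ⟨1, by rw [pow_one, h]⟩ : IsPGroup p G)
  rw [hk] at h2 ⊢
  have : k < 2 := by
    by_contra! hk2
    exact h2 (pow_dvd_pow p hk2)
  simpa using pow_dvd_pow p (Nat.lt_succ_iff.1 this)

namespace HasEllipticTori

variable {G : Type*} [Group G] {Q : ℕ} (hG : HasEllipticTori G Q)

include hG

theorem finite (hQ : 2 ≤ Q) : Finite G := by
  apply Nat.finite_of_card_ne_zero
  rw [hG.card_eq]
  have : 2 ^ 2 ≤ Q ^ 2 := Nat.pow_le_pow_left hQ 2
  exact Nat.mul_ne_zero (by omega) (by omega)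

theorem card_eq_mul (hQ : 2 ≤ Q) : ∃ a : ℕ, Q = a + 1 ∧ Nat.card G = (Q + 1) * (Q * a) := by
  obtain ⟨a, rfl⟩ : ∃ a, Q = a + 1 := ⟨Q - 1, by omega⟩
  refine ⟨a, rfl, ?_⟩
  rw [hG.card_eq, show (a + 1) ^ 2 - 1 = a * (a + 2) by
    rw [show (a + 1) ^ 2 = a * (a + 2) + 1 by ring, Nat.add_sub_cancel]]
  ring

theorem dvd_card (hQ : 3 ≤ Q) : Q + 1 ∣ Nat.card G := by
  obtain ⟨a, -, h⟩ := hG.card_eq_mul (by omega)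
  exact ⟨_, h⟩

variable (hq : (Q + 1).Prime) (hQ : 3 ≤ Q)

include hq hQ

theorem not_sq_dvd_card : ¬ (Q + 1) ^ 2 ∣ Nat.card G := by
  obtain ⟨a, rfl, h⟩ := hG.card_eq_mul (by omega)
  rw [h, sq]
  intro hd
  have := Nat.dvd_of_mul_dvd_mul_left (by omega) hd
  rcases (Nat.Prime.dvd_mul hq).1 this with h | h
  · have := Nat.le_of_dvd (by omega) h
    omega
  · have := Nat.le_of_dvd (by omega) h
    omega

theorem mem_zpowers_of_commute {c g : G} (hc : orderOf c = Q + 1) (hg : Commute g c) :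
    g ∈ Subgroup.zpowers c := by
  have := hG.finite (by omega)
  have hle : Subgroup.zpowers c ≤ Subgroup.centralizer {c} := by
    rw [Subgroup.zpowers_le, Subgroup.mem_centralizer_singleton_iff]
  have hdvd : Nat.card (Subgroup.centralizer {c}) ∣ Q + 1 := by
    refine card_eq_of_forall_pow_eq hq (fun x => Subtype.ext ?_) fun h =>
      hG.not_sq_dvd_card hq hQ (h.trans (Subgroup.card_subgroup_dvd_card _))
    exact hG.pow_eq_one_of_commute hc (Subgroup.mem_centralizer_singleton_iff.1 x.2)
  have heq : Subgroup.zpowers c = Subgroup.centralizer {c} := by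
    apply Subgroup.eq_of_le_of_card_ge hle
    rw [Nat.card_zpowers, hc]
    exact Nat.le_of_dvd (by omega) hdvd
  rw [heq, Subgroup.mem_centralizer_singleton_iff]
  exact hg

/-- A dihedral subgroup of order `2 (Q + 1)` is the normaliser of the torus generated by any of its
elements of order `Q + 1`. -/
theorem mem_iff {D : Subgroup G} (e : D ≃* DihedralGroup (Q + 1)) {c : G} (hc : orderOf c = Q + 1)
    (hcD : c ∈ D) {g : G} : g ∈ D ↔ g * c * g⁻¹ = c ∨ g * c * g⁻¹ = c⁻¹ := by
  obtain ⟨i, hi⟩ := DihedralGroup.exists_eq_r_of_orderOf_eq (n := Q + 1) (by omega)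
    (x := e ⟨c, hcD⟩) (by rw [MulEquiv.orderOf_eq, Subgroup.orderOf_mk, hc])
  constructor
  · intro hg
    have := DihedralGroup.conj_r_mem (e ⟨g, hg⟩) i
    rw [← hi, ← map_inv, ← map_inv, ← map_mul, ← map_mul, e.injective.eq_iff, e.injective.eq_iff,
      Subtype.ext_iff, Subtype.ext_iff] at this
    exact this
  · have hz : ∀ g : G, g * c * g⁻¹ = c → g ∈ D := fun g hg =>
      (Subgroup.zpowers_le.2 hcD) (hG.mem_zpowers_of_commute hq hQ hc (mul_inv_eq_iff_eq_mul.1 hg))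
    rintro (hg | hg)
    · exact hz g hg
    · let s : G := e.symm (DihedralGroup.sr 0)
      have hs : s * c * s⁻¹ = c⁻¹ := by
        have : e.symm (DihedralGroup.sr 0) * ⟨c, hcD⟩ * (e.symm (DihedralGroup.sr 0))⁻¹ =
            (⟨c, hcD⟩ : D)⁻¹ := by
          apply e.injective
          simp [hi]
        exact congrArg Subtype.val this
      have hsg : s * g ∈ D := by
        apply hz
        rw [show s * g * c * (s * g)⁻¹ = (s * (g * c * g⁻¹)⁻¹ * s⁻¹)⁻¹ by group, hg, inv_inv, hs,
          inv_inv]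
      exact (Subgroup.mul_mem_cancel_left D (e.symm (DihedralGroup.sr 0)).2).1 hsg

theorem eq_of_mem {D D' : Subgroup G} (e : D ≃* DihedralGroup (Q + 1))
    (e' : D' ≃* DihedralGroup (Q + 1)) {c : G} (hc : orderOf c = Q + 1) (hcD : c ∈ D)
    (hcD' : c ∈ D') : D = D' := by
  ext g
  rw [hG.mem_iff hq hQ e hc hcD, hG.mem_iff hq hQ e' hc hcD']

end HasEllipticTori

section

variable {G : Type*} [Group G] {n : ℕ} {D : Subgroup G} (e : D ≃* DihedralGroup n)

theorem exists_orderOf_of_dihedral (e : D ≃* DihedralGroup n) : ∃ c ∈ D, orderOf c = n := by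
  refine ⟨e.symm (DihedralGroup.r 1), Subtype.prop _, ?_⟩
  rw [Subgroup.orderOf_coe, MulEquiv.orderOf_eq, DihedralGroup.orderOf_r_one]

theorem card_of_dihedral (e : D ≃* DihedralGroup n) : Nat.card D = 2 * n :=
  (Nat.card_congr e.toEquiv).trans DihedralGroup.nat_card

end

namespace HasEllipticTori

variable {G : Type*} [Group G] {Q : ℕ} (hG : HasEllipticTori G Q) (hq : (Q + 1).Prime) (hQ : 3 ≤ Q)

include hG hq hQ

theorem exists_dihedral : ∃ D : Subgroup G, Nonempty (D ≃* DihedralGroup (Q + 1)) := by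
  have := hG.finite (by omega)
  have : Fact (Q + 1).Prime := ⟨hq⟩
  obtain ⟨c, hc⟩ := exists_prime_orderOf_dvd_card' (Q + 1) (hG.dvd_card hQ)
  obtain ⟨t, ht, h, -⟩ := hG.exists_inverting hc hc
  obtain ⟨f, hf⟩ := DihedralGroup.exists_hom (by omega) hc ht h
  exact ⟨f.range, ⟨(f.ofInjective hf).symm⟩⟩

/-- Any two distinct dihedral subgroups of order `2 (Q + 1)` meet in a group of order two. -/
theorem exists_inf_eq_zpowers {D D' : Subgroup G} (e : D ≃* DihedralGroup (Q + 1))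
    (e' : D' ≃* DihedralGroup (Q + 1)) (hne : D ≠ D') :
    ∃ t : G, orderOf t = 2 ∧ D ⊓ D' = Subgroup.zpowers t := by
  obtain ⟨c, hcD, hc⟩ := exists_orderOf_of_dihedral e
  obtain ⟨c', hcD', hc'⟩ := exists_orderOf_of_dihedral e'
  obtain ⟨t, ht, h1, h2⟩ := hG.exists_inverting hc hc'
  have htD : t ∈ D := (hG.mem_iff hq hQ e hc hcD).2 (Or.inr h1)
  have htD' : t ∈ D' := (hG.mem_iff hq hQ e' hc' hcD').2 (Or.inr h2)
  have hodd : Odd (Q + 1) := hq.odd_of_ne_two (by omega)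
  have hr (x : G) (hx : x ∈ D) (hx' : x ∈ D') (i) (hi : e ⟨x, hx⟩ = DihedralGroup.r i) : x = 1 := by
    by_contra h
    apply hne
    refine hG.eq_of_mem hq hQ e e' (c := x) ?_ hx hx'
    rw [← Subgroup.orderOf_mk x hx, ← MulEquiv.orderOf_eq e, hi]
    apply DihedralGroup.orderOf_r_of_prime hq
    rw [← hi]
    simpa [Subtype.ext_iff] using h
  refine ⟨t, ht, le_antisymm ?_ (Subgroup.zpowers_le.2 ⟨htD, htD'⟩)⟩
  rintro x ⟨hx, hx'⟩
  obtain ⟨j, hj⟩ := DihedralGroup.exists_eq_sr_of_orderOf_eq_two hodd (x := e ⟨t, htD⟩)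
    (by rw [MulEquiv.orderOf_eq, Subgroup.orderOf_mk, ht])
  rcases hi : e ⟨x, hx⟩ with i | i
  · rw [hr x hx hx' i hi]
    exact one_mem _
  · have : x * t = 1 := by
      refine hr _ (mul_mem hx htD) (mul_mem hx' htD') (j - i) ?_
      rw [← DihedralGroup.sr_mul_sr, ← hi, ← hj, ← map_mul]
      rfl
    rw [eq_inv_of_mul_eq_one_left this]
    exact inv_mem (Subgroup.mem_zpowers t)

/-- All dihedral subgroups of order `2 (Q + 1)` are conjugate, as their tori are Sylow subgroups. -/
theorem exists_conj_eq {D D' : Subgroup G} (e : D ≃* DihedralGroup (Q + 1))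
    (e' : D' ≃* DihedralGroup (Q + 1)) : ∃ g : G, MulAut.conj g • D = D' := by
  have := hG.finite (by omega)
  have : Fact (Q + 1).Prime := ⟨hq⟩
  obtain ⟨c, hcD, hc⟩ := exists_orderOf_of_dihedral e
  obtain ⟨c', hcD', hc'⟩ := exists_orderOf_of_dihedral e'
  have hfac : (Nat.card G).factorization (Q + 1) = 1 := by
    have h0 : Nat.card G ≠ 0 := Nat.card_pos.ne'
    apply le_antisymm
    · by_contra! h
      exact hG.not_sq_dvd_card hq hQ ((hq.pow_dvd_iff_le_factorization h0).2 h)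
    · exact (hq.dvd_iff_one_le_factorization h0).1 (hG.dvd_card hQ)
  have hcard (c : G) (hc : orderOf c = Q + 1) :
      Nat.card (Subgroup.zpowers c) = (Q + 1) ^ (Nat.card G).factorization (Q + 1) := by
    rw [hfac, pow_one, Nat.card_zpowers, hc]
  obtain ⟨g, hg⟩ := MulAction.exists_smul_eq G (Sylow.ofCard _ (hcard c hc))
    (Sylow.ofCard _ (hcard c' hc'))
  have hg' : MulAut.conj g • Subgroup.zpowers c = Subgroup.zpowers c' :=
    congrArg (fun P : Sylow (Q + 1) G => (P : Subgroup G)) hg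
  refine ⟨g, ?_⟩
  have hcg : MulAut.conj g c ∈ D' := by
    have : MulAut.conj g c ∈ MulAut.conj g • Subgroup.zpowers c :=
      Subgroup.smul_mem_pointwise_smul _ _ _ (Subgroup.mem_zpowers c)
    rw [hg'] at this
    exact Subgroup.zpowers_le.2 hcD' this
  exact hG.eq_of_mem hq hQ ((Subgroup.equivSMul (MulAut.conj g) D).symm.trans e) e'
    ((MulEquiv.orderOf_eq (MulAut.conj g) c).trans hc)
    (Subgroup.smul_mem_pointwise_smul _ _ _ hcD) hcg

/-- A dihedral subgroup of order `2 (Q + 1)` is its own normaliser. -/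
theorem mem_of_conj_eq {D : Subgroup G} (e : D ≃* DihedralGroup (Q + 1)) {g : G}
    (hg : MulAut.conj g • D = D) : g ∈ D := by
  obtain ⟨c, hcD, hc⟩ := exists_orderOf_of_dihedral e
  have hcg : g * c * g⁻¹ ∈ D := by
    have := Subgroup.smul_mem_pointwise_smul c (MulAut.conj g) D hcD
    rwa [hg] at this
  have hcg' : orderOf (g * c * g⁻¹) = Q + 1 :=
    (MulEquiv.orderOf_eq (MulAut.conj g) c).trans hc
  obtain ⟨i, hi⟩ := DihedralGroup.exists_eq_r_of_orderOf_eq (n := Q + 1) (by omega)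
    (x := e ⟨c, hcD⟩) (by rw [MulEquiv.orderOf_eq, Subgroup.orderOf_mk, hc])
  obtain ⟨j, hj⟩ := DihedralGroup.exists_eq_r_of_orderOf_eq (n := Q + 1) (by omega)
    (x := e ⟨_, hcg⟩) (by rw [MulEquiv.orderOf_eq, Subgroup.orderOf_mk, hcg'])
  rw [hG.mem_iff hq hQ e hc hcD]
  apply hG.eq_or_eq_inv_of_commute hc
  have : (⟨_, hcg⟩ : D) * ⟨c, hcD⟩ = ⟨c, hcD⟩ * ⟨_, hcg⟩ := by
    apply e.injective
    rw [map_mul, map_mul, hi, hj, DihedralGroup.r_mul_r, DihedralGroup.r_mul_r, add_comm j]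
  exact congrArg Subtype.val this

end HasEllipticTori

/-! ### Linear spaces, counting, and Property (⋆) -/

theorem Set.ncard_mul_eq_ncard_mul {α β : Type*} {s : Set α} {t : Set β} (hs : s.Finite)
    (ht : t.Finite) (r : α → β → Prop) {m n : ℕ} (hm : ∀ a ∈ s, {b ∈ t | r a b}.ncard = m)
    (hn : ∀ b ∈ t, {a ∈ s | r a b}.ncard = n) : s.ncard * m = t.ncard * n := by
  classical
  lift s to Finset α using hs
  lift t to Finset β using ht
  rw [Set.ncard_coe_finset, Set.ncard_coe_finset]
  refine Finset.card_mul_eq_card_mul r (fun a ha => ?_) (fun b hb => ?_)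
  · rw [← hm a ha, ← Set.ncard_coe_finset, Finset.coe_bipartiteAbove]
    rfl
  · rw [← hn b hb, ← Set.ncard_coe_finset, Finset.coe_bipartiteBelow]
    rfl

/-- Counting the flags of a point-line structure with constant parameters `k` and `r`. -/
theorem ncard_mul_of_ncard_eq {P : Type*} [Finite P] {L : Set (Set P)} {k r : ℕ}
    (hk : ∀ l ∈ L, l.ncard = k) (hr : ∀ u, {l ∈ L | u ∈ l}.ncard = r) :
    L.ncard * k = Nat.card P * r := by
  rw [← Set.ncard_univ P]
  refine Set.ncard_mul_eq_ncard_mul (Set.toFinite _) (Set.toFinite _) (fun l u => u ∈ l) ?_ ?_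
  · intro l hl
    rw [← hk l hl]
    congr 1
    ext
    simp
  · intro u _
    exact hr u

namespace IsLinearSpace

variable {P : Type*} {L : Set (Set P)}

theorem eq_of_mem (hL : IsLinearSpace L) {u v : P} (huv : u ≠ v) {l l' : Set P} (hl : l ∈ L)
    (hl' : l' ∈ L) (hu : u ∈ l) (hv : v ∈ l) (hu' : u ∈ l') (hv' : v ∈ l') : l = l' :=
  (hL u v huv).unique ⟨hl, hu, hv⟩ ⟨hl', hu', hv'⟩

variable [Finite P] (hL : IsLinearSpace L) {k : ℕ} (hk : ∀ l ∈ L, l.ncard = k + 1)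

include hL hk

/-- Counting the points other than `u` on the lines through `u`. -/
theorem ncard_lines_through_mul (u : P) : {l ∈ L | u ∈ l}.ncard * k + 1 = Nat.card P := by
  have h := Set.ncard_mul_eq_ncard_mul (Set.toFinite {l ∈ L | u ∈ l}) (Set.toFinite {v : P | v ≠ u})
    (fun l v => v ∈ l) (m := k) (n := 1) ?_ ?_
  · have h1 : {v : P | v ≠ u} = Set.univ \ {u} := by ext; simp
    rw [h, mul_one, h1, Set.ncard_sdiff_singleton_add_one (Set.mem_univ u), Set.ncard_univ]
  · rintro l ⟨hl, hu⟩
    have h1 : {v ∈ {v : P | v ≠ u} | v ∈ l} = l \ {u} := by ext; simp [and_comm]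
    rw [h1, Set.ncard_sdiff_singleton_of_mem hu, hk l hl, Nat.add_sub_cancel]
  · intro v hv
    obtain ⟨l, ⟨hl, hu, hv'⟩, huniq⟩ := hL u v (Ne.symm hv)
    rw [Set.ncard_eq_one]
    refine ⟨l, Set.eq_singleton_iff_unique_mem.2 ⟨⟨⟨hl, hu⟩, hv'⟩, ?_⟩⟩
    rintro l' ⟨⟨hl', hu'⟩, hv''⟩
    exact huniq l' ⟨hl', hu', hv''⟩

end IsLinearSpace

section LS

variable {G : Type*} [Group G] {P : Type*} [MulAction G P]

theorem mem_pairStabilizer {u v : P} {g : G} :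
    g ∈ pairStabilizer G u v ↔ g • u = u ∧ g • v = v := by
  simp [pairStabilizer, Subgroup.mem_inf]

theorem pairStabilizer_comm (u v : P) : pairStabilizer G u v = pairStabilizer G v u := inf_comm _ _

theorem PropertyStar.pairStabilizer_eq (h : PropertyStar G P) {u v w : P} (huw : u ≠ w)
    (hw : pairStabilizer G u v ≤ MulAction.stabilizer G w) :
    pairStabilizer G u v = pairStabilizer G u w :=
  le_antisymm (le_inf inf_le_left hw) (le_inf inf_le_left (h u v w huw hw))

/-- Under Property (⋆) the line `Λ_{uv}` is determined by any two of its points. -/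
theorem PropertyStar.pairStabilizer_eq_of_mem (h : PropertyStar G P) {u v w w' : P} (hww' : w ≠ w')
    (huv : u ≠ v) (hw : pairStabilizer G u v ≤ MulAction.stabilizer G w)
    (hw' : pairStabilizer G u v ≤ MulAction.stabilizer G w') :
    pairStabilizer G u v = pairStabilizer G w w' := by
  have key : ∀ {u v w w' : P}, w ≠ w' → u ≠ w → pairStabilizer G u v ≤ MulAction.stabilizer G w →
      pairStabilizer G u v ≤ MulAction.stabilizer G w' →
      pairStabilizer G u v = pairStabilizer G w w' := by
    intro u v w w' hww' huw hw hw'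
    have h1 := h.pairStabilizer_eq huw hw
    rw [h1, pairStabilizer_comm] at hw'
    rw [h1, pairStabilizer_comm u w]
    exact h.pairStabilizer_eq hww' hw'
  by_cases huw : u = w
  · rw [pairStabilizer_comm] at hw hw' ⊢
    exact key hww' (fun h => huv (huw.trans h.symm)) hw hw'
  · exact key hww' huw hw hw'

theorem PropertyStar.isLinearSpace (h : PropertyStar G P) : IsLinearSpace (lsLines G P) := by
  intro u v huv
  refine ⟨_, ⟨⟨u, v, huv, rfl⟩, Set.mem_ofPred.2 inf_le_left, Set.mem_ofPred.2 inf_le_right⟩, ?_⟩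
  rintro _ ⟨⟨u', v', hne, rfl⟩, hu, hv⟩
  ext w
  rw [Set.mem_ofPred_eq, Set.mem_ofPred_eq, h.pairStabilizer_eq_of_mem huv hne hu hv]

theorem smul_mem_lsLines (g : G) {l : Set P} (hl : l ∈ lsLines G P) : g • l ∈ lsLines G P := by
  obtain ⟨u, v, huv, rfl⟩ := hl
  refine ⟨g • u, g • v, (MulAction.injective g).ne huv, ?_⟩
  ext w
  rw [Set.mem_smul_set_iff_inv_smul_mem, Set.mem_ofPred_eq, Set.mem_ofPred_eq, SetLike.le_def,
    SetLike.le_def]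
  simp only [mem_pairStabilizer, MulAction.mem_stabilizer_iff]
  constructor
  · rintro h x ⟨hu, hv⟩
    have := @h (g⁻¹ * x * g) ⟨by simp [mul_smul, hu], by simp [mul_smul, hv]⟩
    simpa [mul_smul, inv_smul_eq_iff] using this
  · rintro h x ⟨hu, hv⟩
    have := @h (g * x * g⁻¹) ⟨by simp [mul_smul, hu], by simp [mul_smul, hv]⟩
    simpa [mul_smul, ← eq_inv_smul_iff] using this

theorem actsOnSpace_iff {L : Set (Set P)} :
    ActsOnSpace G L ↔ ∀ (g : G) (l : Set P), l ∈ L → g • l ∈ L := by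
  constructor
  · intro h g l hl
    exact (h ⟨g, rfl⟩ l).2 hl
  · rintro h _ ⟨g, rfl⟩ l
    refine ⟨fun hl => ?_, fun hl => h g l hl⟩
    have := h g⁻¹ _ hl
    rwa [show (MulAction.toPermHom G P g '' l : Set P) = g • l from rfl, inv_smul_smul] at this

theorem actsOnSpace_lsLines : ActsOnSpace G (lsLines G P) :=
  actsOnSpace_iff.2 fun g _ hl => smul_mem_lsLines g hl

end LS

section Induced

variable {G : Type*} [Group G] {P : Type*} [MulAction G P] {l : Set P}

theorem mem_inducedGroup {σ : Equiv.Perm l} :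
    σ ∈ inducedGroup G l ↔ ∃ g : G, g • l = l ∧ ∀ x : l, (σ x : P) = g • (x : P) := by
  constructor
  · rintro ⟨g, rfl⟩
    exact ⟨g, g.2, fun x => rfl⟩
  · rintro ⟨g, hg, h⟩
    exact ⟨⟨g, hg⟩, Equiv.ext fun x => Subtype.ext (h x).symm⟩

theorem coe_image_inducedGroup {σ : Equiv.Perm l} {g : G} (h : ∀ x : l, (σ x : P) = g • (x : P))
    (s : Set l) : (Subtype.val '' (σ '' s) : Set P) = g • (Subtype.val '' s : Set P) := by
  ext y
  simp only [Set.mem_image, Set.mem_smul_set, exists_exists_and_eq_and, h]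

end Induced

/-- A group of exponent two is isomorphic to any additive group of exponent two and the same finite
order, since both are vector spaces over the field with two elements. -/
theorem nonempty_mulEquiv_of_sq_eq_one {B F : Type*} [Group B] [AddCommGroup F]
    (hB : ∀ b : B, b ^ 2 = 1) (hF : ∀ x : F, 2 • x = 0) [Finite B] [Finite F]
    (hcard : Nat.card B = Nat.card F) : Nonempty (B ≃* Multiplicative F) := by
  have hinv (b : B) : b⁻¹ = b := inv_eq_of_mul_eq_one_left ((sq b).symm.trans (hB b))
  let : CommGroup B :=
    { ‹Group B› with
      mul_comm := fun a b => by rw [← hinv (a * b), mul_inv_rev, hinv, hinv] }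
  let : Module (ZMod 2) (Additive B) := AddCommGroup.zmodModule fun b => hB b.toMul
  let : Module (ZMod 2) F := AddCommGroup.zmodModule hF
  have hfin : Module.finrank (ZMod 2) (Additive B) = Module.finrank (ZMod 2) F := by
    have h1 := Module.natCard_eq_pow_finrank (K := ZMod 2) (V := Additive B)
    have h2 := Module.natCard_eq_pow_finrank (K := ZMod 2) (V := F)
    have h3 : Nat.card (Additive B) = Nat.card F := hcard
    rw [h1, h2, Nat.card_zmod] at h3
    exact Nat.pow_right_injective le_rfl h3
  exact ⟨AddEquiv.toMultiplicativeRight (LinearEquiv.ofFinrankEq _ _ hfin).toAddEquiv⟩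

/-! ### The action on the cosets of a dihedral subgroup -/

theorem mem_zpowers_iff_of_orderOf_eq_two {G : Type*} [Group G] {t g : G} (ht : orderOf t = 2) :
    g ∈ Subgroup.zpowers t ↔ g = 1 ∨ g = t := by
  constructor
  · rintro ⟨k, rfl⟩
    have : t ^ (k % 2) = t ^ k := by simpa [ht] using zpow_mod_orderOf t k
    dsimp only
    rcases Int.emod_two_eq_zero_or_one k with h | h
    · left; rw [← this, h, zpow_zero]
    · right; rw [← this, h, zpow_one]
  · rintro (rfl | rfl)
    · exact one_mem _
    · exact Subgroup.mem_zpowers g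

/-- The orbit-stabiliser theorem for a point whose stabiliser in `K` is `{1, t}`. -/
theorem ncard_orbit_mul_two {G X : Type*} [Group G] [MulAction G X] {K : Subgroup G} {t : G}
    (ht : orderOf t = 2) (htK : t ∈ K) {x : X} (htx : t • x = x)
    (h : ∀ g ∈ K, g • x = x → g = 1 ∨ g = t) :
    (MulAction.orbit K x).ncard * 2 = Nat.card K := by
  have hs : MulAction.stabilizer K x = Subgroup.zpowers ⟨t, htK⟩ := by
    have ht' : orderOf (⟨t, htK⟩ : K) = 2 := by rw [Subgroup.orderOf_mk, ht]
    ext g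
    rw [mem_zpowers_iff_of_orderOf_eq_two ht', MulAction.mem_stabilizer_iff]
    constructor
    · intro hg
      exact (h g g.2 hg).imp (fun h => Subtype.ext h) (fun h => Subtype.ext h)
    · rintro (rfl | rfl)
      · exact one_smul _ x
      · exact htx
  rw [← MulAction.index_stabilizer, mul_comm, ← Subgroup.card_mul_index (MulAction.stabilizer K x)]
  congr 1
  rw [hs, Nat.card_zpowers, Subgroup.orderOf_mk, ht]

/-- The action of `G` on the cosets of a dihedral subgroup `D` of order `2 q`, up to isomorphism.
Here `G` has elliptic tori for `Q = 2 P`, and `q = 2 P + 1` is prime. That `D` is its own normaliser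
is expressed by the condition that distinct points have distinct stabilisers. -/
structure IsTorusAction (G X : Type*) [Group G] [MulAction G X] (P : ℕ) : Prop where
  tori : HasEllipticTori G (2 * P)
  prime : (2 * P + 1).Prime
  two_le : 2 ≤ P
  nonempty : Nonempty X
  pretransitive : MulAction.IsPretransitive G X
  stabilizer_equiv (u : X) : Nonempty (MulAction.stabilizer G u ≃* DihedralGroup (2 * P + 1))
  stabilizer_injective : Function.Injective (MulAction.stabilizer G : X → Subgroup G)

theorem HasEllipticTori.isTorusAction {G : Type*} [Group G] {P : ℕ} (hG : HasEllipticTori G (2 * P))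
    (hq : (2 * P + 1).Prime) (hP : 2 ≤ P) {D : Subgroup G} (e : D ≃* DihedralGroup (2 * P + 1)) :
    IsTorusAction G (G ⧸ D) P where
  tori := hG
  prime := hq
  two_le := hP
  nonempty := ⟨((1 : G) : G ⧸ D)⟩
  pretransitive := inferInstance
  stabilizer_equiv u := by
    obtain ⟨g, rfl⟩ := MulAction.exists_smul_eq G ((1 : G) : G ⧸ D) u
    refine ⟨(MulAction.stabilizerEquivStabilizer rfl).symm.trans
      ((MulEquiv.subgroupCongr (MulAction.stabilizer_quotient D)).trans e)⟩
  stabilizer_injective := by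
    intro u v h
    obtain ⟨g, rfl⟩ := QuotientGroup.mk_surjective u
    obtain ⟨k, rfl⟩ := QuotientGroup.mk_surjective v
    have hs (g : G) : MulAction.stabilizer G (g : G ⧸ D) = MulAut.conj g • D := by
      have := MulAction.stabilizer_smul_eq_stabilizer_map_conj g ((1 : G) : G ⧸ D)
      rw [MulAction.stabilizer_quotient] at this
      rw [← mul_one g]
      exact this.trans (by rw [mul_one]; rfl)
    rw [hs, hs, ← inv_smul_eq_iff, smul_smul, ← map_inv, ← map_mul] at h
    exact (QuotientGroup.eq.2 (hG.mem_of_conj_eq hq (by omega) e h)).symm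

namespace IsTorusAction

variable {G X : Type*} [Group G] [MulAction G X] {P : ℕ} (h : IsTorusAction G X P)

include h

theorem finite_group : Finite G := h.tori.finite (by have := h.two_le; omega)

theorem finite : Finite X := by
  have := h.finite_group
  obtain ⟨u⟩ := h.nonempty
  have := h.pretransitive
  exact Finite.of_surjective (fun g : G => g • u) (MulAction.surjective_smul G u)

theorem card_stabilizer (u : X) : Nat.card (MulAction.stabilizer G u) = 2 * (2 * P + 1) := by
  obtain ⟨e⟩ := h.stabilizer_equiv u
  exact card_of_dihedral e

theorem card_eq : Nat.card X = P * (2 * P - 1) := by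
  obtain ⟨u⟩ := h.nonempty
  have := h.pretransitive
  have h1 := Subgroup.card_mul_index (MulAction.stabilizer G u)
  rw [h.card_stabilizer, MulAction.index_stabilizer_of_transitive] at h1
  have hP := h.two_le
  obtain ⟨a, ha, h2⟩ := h.tori.card_eq_mul (by omega)
  obtain rfl : a = 2 * P - 1 := by omega
  apply Nat.eq_of_mul_eq_mul_left (show 0 < 2 * (2 * P + 1) by omega)
  rw [h1, h2]
  ring

/-- The stabiliser of two distinct points has order two, as it is the intersection of two dihedral
subgroups. -/
theorem pairStabilizer_eq {u v : X} (huv : u ≠ v) :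
    ∃ t : G, orderOf t = 2 ∧ pairStabilizer G u v = Subgroup.zpowers t := by
  obtain ⟨e⟩ := h.stabilizer_equiv u
  obtain ⟨e'⟩ := h.stabilizer_equiv v
  exact h.tori.exists_inf_eq_zpowers h.prime (by have := h.two_le; omega) e e'
    (h.stabilizer_injective.ne huv)

theorem eq_one_or_eq {u v : X} (huv : u ≠ v) {t g : G} (ht : orderOf t = 2) (htu : t • u = u)
    (htv : t • v = v) (hgu : g • u = u) (hgv : g • v = v) : g = 1 ∨ g = t := by
  obtain ⟨s, hs, hst⟩ := h.pairStabilizer_eq huv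
  have h1 : t ∈ pairStabilizer G u v := mem_pairStabilizer.2 ⟨htu, htv⟩
  have h2 : g ∈ pairStabilizer G u v := mem_pairStabilizer.2 ⟨hgu, hgv⟩
  rw [hst, mem_zpowers_iff_of_orderOf_eq_two hs] at h1 h2
  rcases h1 with rfl | rfl
  · simp at ht
  · exact h2

theorem pairStabilizer_eq_zpowers {u v : X} (huv : u ≠ v) {t : G} (ht : orderOf t = 2)
    (htu : t • u = u) (htv : t • v = v) : pairStabilizer G u v = Subgroup.zpowers t := by
  ext g
  rw [mem_zpowers_iff_of_orderOf_eq_two ht, mem_pairStabilizer]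
  constructor
  · rintro ⟨hu, hv⟩
    exact h.eq_one_or_eq huv ht htu htv hu hv
  · rintro (rfl | rfl)
    · simp
    · exact ⟨htu, htv⟩

theorem eq_of_fix {u v : X} (huv : u ≠ v) {t s : G} (ht : orderOf t = 2) (hs : orderOf s = 2)
    (htu : t • u = u) (htv : t • v = v) (hsu : s • u = u) (hsv : s • v = v) : s = t := by
  rcases h.eq_one_or_eq huv ht htu htv hsu hsv with rfl | hst
  · simp at hs
  · exact hst

/-- An involution is its own centraliser in a point stabiliser, up to the identity. -/
theorem eq_one_or_eq_of_commute {u : X} {t g : G} (ht : orderOf t = 2) (htu : t • u = u)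
    (hgu : g • u = u) (hgt : Commute g t) : g = 1 ∨ g = t := by
  obtain ⟨e⟩ := h.stabilizer_equiv u
  have := DihedralGroup.eq_of_commute (odd_two_mul_add_one P)
    (x := e ⟨g, hgu⟩) (t := e ⟨t, htu⟩)
    ((MulEquiv.orderOf_eq _ _).trans ((Subgroup.orderOf_mk _ _).trans ht))
    (Commute.map (Subtype.ext hgt.eq : Commute (⟨g, hgu⟩ : MulAction.stabilizer G u) ⟨t, htu⟩) e)
  simpa [Subtype.ext_iff] using this

theorem exists_conj_eq {u : X} {t s : G} (ht : orderOf t = 2) (hs : orderOf s = 2)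
    (htu : t • u = u) (hsu : s • u = u) : ∃ g : G, g • u = u ∧ g * t * g⁻¹ = s := by
  obtain ⟨e⟩ := h.stabilizer_equiv u
  have hc := DihedralGroup.isConj_of_orderOf_eq_two (odd_two_mul_add_one P)
    (x := e ⟨t, htu⟩) (y := e ⟨s, hsu⟩)
    ((MulEquiv.orderOf_eq _ _).trans ((Subgroup.orderOf_mk _ _).trans ht))
    ((MulEquiv.orderOf_eq _ _).trans ((Subgroup.orderOf_mk _ _).trans hs))
  have hc' := e.symm.toMonoidHom.map_isConj hc
  obtain ⟨g, hg⟩ := isConj_iff.1 hc'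
  refine ⟨g, g.2, ?_⟩
  simpa [Subtype.ext_iff] using hg

theorem propertyStar : PropertyStar G X := by
  intro u v w huw hw
  by_cases huv : u = v
  · subst huv
    intro x hx
    exact (mem_pairStabilizer.1 hx).1
  · obtain ⟨t, ht, htuv⟩ := h.pairStabilizer_eq huv
    have htm : t ∈ pairStabilizer G u v := htuv ▸ Subgroup.mem_zpowers t
    obtain ⟨htu, htv⟩ := mem_pairStabilizer.1 htm
    rw [h.pairStabilizer_eq_zpowers huw ht htu (hw htm), Subgroup.zpowers_le]
    exact htv

theorem isLinearSpace : IsLinearSpace (lsLines G X) := h.propertyStar.isLinearSpace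

theorem fixedBy_nonempty {t : G} (ht : orderOf t = 2) : (MulAction.fixedBy X t).Nonempty := by
  obtain ⟨u⟩ := h.nonempty
  obtain ⟨e⟩ := h.stabilizer_equiv u
  let s : G := e.symm (DihedralGroup.sr 0)
  have hs : orderOf s = 2 := by
    rw [Subgroup.orderOf_coe, MulEquiv.orderOf_eq, DihedralGroup.orderOf_sr]
  have hsu : s • u = u := (e.symm (DihedralGroup.sr 0)).2
  obtain ⟨g, hg⟩ := isConj_iff.1 (h.tori.isConj_of_orderOf_eq_two hs ht)
  refine ⟨g • u, ?_⟩
  rw [MulAction.mem_fixedBy, ← hg]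
  simp [mul_smul, hsu]

theorem fixedBy_eq_orbit {t : G} (ht : orderOf t = 2) {u : X} (hu : t • u = u) :
    MulAction.fixedBy X t = MulAction.orbit (Subgroup.centralizer {t}) u := by
  have := h.pretransitive
  ext v
  rw [MulAction.mem_fixedBy, MulAction.mem_orbit_iff]
  constructor
  · intro hv
    obtain ⟨g, rfl⟩ := MulAction.exists_smul_eq G u v
    have h1 : (g⁻¹ * t * g) • u = u := by rw [mul_smul, mul_smul, hv, inv_smul_smul]
    have h2 : orderOf (g⁻¹ * t * g) = 2 := by
      have := MulEquiv.orderOf_eq (MulAut.conj g⁻¹) t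
      rw [MulAut.conj_apply, inv_inv] at this
      exact this.trans ht
    obtain ⟨d, hd, hdt⟩ := h.exists_conj_eq ht h2 hu h1
    refine ⟨⟨g * d, ?_⟩, ?_⟩
    · rw [Subgroup.mem_centralizer_singleton_iff, ← mul_inv_eq_iff_eq_mul, mul_inv_rev,
        show g * d * t * (d⁻¹ * g⁻¹) = g * (d * t * d⁻¹) * g⁻¹ by group, hdt]
      group
    · change (g * d) • u = g • u
      rw [mul_smul, hd]
  · rintro ⟨⟨g, hg⟩, rfl⟩
    rw [Subgroup.mem_centralizer_singleton_iff] at hg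
    change t • g • u = g • u
    rw [← mul_smul, ← hg, mul_smul, hu]

theorem ncard_fixedBy {t : G} (ht : orderOf t = 2) : (MulAction.fixedBy X t).ncard = P := by
  obtain ⟨u, hu⟩ := h.fixedBy_nonempty ht
  have := ncard_orbit_mul_two ht (K := Subgroup.centralizer {t}) (x := u)
    (Subgroup.mem_centralizer_singleton_iff.2 rfl) hu fun g hg hgu =>
      h.eq_one_or_eq_of_commute ht hu hgu (Subgroup.mem_centralizer_singleton_iff.1 hg)
  rw [← h.fixedBy_eq_orbit ht hu, h.tori.card_centralizer ht] at this
  omega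

theorem exists_ne_mem_fixedBy {t : G} (ht : orderOf t = 2) :
    ∃ u v : X, u ≠ v ∧ t • u = u ∧ t • v = v := by
  have := h.finite
  have h1 : 1 < (MulAction.fixedBy X t).ncard := by rw [h.ncard_fixedBy ht]; exact h.two_le
  obtain ⟨u, hu, v, hv, huv⟩ := (Set.one_lt_ncard_iff_nontrivial).1 h1
  exact ⟨u, v, huv, hu, hv⟩

theorem mem_lsLines_iff {l : Set X} :
    l ∈ lsLines G X ↔ ∃ t : G, orderOf t = 2 ∧ l = MulAction.fixedBy X t := by
  constructor
  · rintro ⟨u, v, huv, rfl⟩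
    obtain ⟨t, ht, htuv⟩ := h.pairStabilizer_eq huv
    refine ⟨t, ht, ?_⟩
    ext w
    rw [Set.mem_ofPred_eq, htuv, Subgroup.zpowers_le, MulAction.mem_stabilizer_iff,
      MulAction.mem_fixedBy]
  · rintro ⟨t, ht, rfl⟩
    obtain ⟨u, v, huv, hu, hv⟩ := h.exists_ne_mem_fixedBy ht
    refine ⟨u, v, huv, ?_⟩
    ext w
    rw [Set.mem_ofPred_eq, h.pairStabilizer_eq_zpowers huv ht hu hv, Subgroup.zpowers_le,
      MulAction.mem_stabilizer_iff, MulAction.mem_fixedBy]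

theorem isLineTransitive : IsLineTransitive G (lsLines G X) := by
  intro l hl l' hl'
  obtain ⟨t, ht, rfl⟩ := h.mem_lsLines_iff.1 hl
  obtain ⟨s, hs, rfl⟩ := h.mem_lsLines_iff.1 hl'
  obtain ⟨g, rfl⟩ := isConj_iff.1 (h.tori.isConj_of_orderOf_eq_two ht hs)
  exact ⟨g, MulAction.smul_fixedBy X t g⟩

/-- An element of `G_u` moving a point of a line through `u` to a point of that line fixes the line
pointwise. -/
theorem eq_one_or_eq_of_smul_mem {t g : G} (ht : orderOf t = 2) {u x : X} (hux : u ≠ x)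
    (hu : t • u = u) (hx : t • x = x) (hgu : g • u = u) (hgx : t • g • x = g • x) :
    g = 1 ∨ g = t := by
  apply h.eq_one_or_eq_of_commute ht hu hgu
  have h2 : orderOf (g⁻¹ * t * g) = 2 := by
    have := MulEquiv.orderOf_eq (MulAut.conj g⁻¹) t
    rw [MulAut.conj_apply, inv_inv] at this
    exact this.trans ht
  have := h.eq_of_fix hux ht h2 hu hx
    (by rw [mul_smul, mul_smul, hgu, hu, inv_smul_eq_iff, hgu])
    (by rw [mul_smul, mul_smul, hgx, inv_smul_smul])
  calc g * t = g * (g⁻¹ * t * g) := by rw [this]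
    _ = t * g := by group

theorem isTransverse : IsTransverse G (lsLines G X) := by
  rintro l hl u hu x y ⟨hy, g, rfl⟩ z ⟨hz, k, rfl⟩
  obtain ⟨t, ht, rfl⟩ := h.mem_lsLines_iff.1 hl
  obtain ⟨g, hg⟩ := g
  obtain ⟨k, hk⟩ := k
  change t • g • x = g • x at hy
  change t • k • x = k • x at hz
  rw [MulAction.mem_stabilizer_iff] at hg hk
  change g • x = k • x
  by_cases hux : u = g • x
  · have hxu : u = x := by rwa [← inv_smul_eq_iff, inv_smul_eq_iff.2 hg.symm] at hux
    rw [← hxu, hg, hk]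
  have h1 : (k * g⁻¹) • g • x = k • x := by rw [mul_smul, inv_smul_smul]
  have := h.eq_one_or_eq_of_smul_mem ht (g := k * g⁻¹) hux hu hy
    (by rw [mul_smul, inv_smul_eq_iff.2 hg.symm, hk]) (by rw [h1, hz])
  rw [← h1]
  rcases this with h2 | h2
  · rw [h2, one_smul]
  · rw [h2, hy]

end IsTorusAction

/-! ### Primitivity -/

namespace IsTorusAction

variable {G X : Type*} [Group G] [MulAction G X] {P : ℕ} (h : IsTorusAction G X P)

include h

theorem ncard_orbit {u x : X} (hux : u ≠ x) :
    (MulAction.orbit (MulAction.stabilizer G u) x).ncard = 2 * P + 1 := by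
  obtain ⟨t, ht, htuv⟩ := h.pairStabilizer_eq hux
  obtain ⟨hu, hx⟩ := mem_pairStabilizer.1 (htuv ▸ Subgroup.mem_zpowers t)
  have := ncard_orbit_mul_two ht (K := MulAction.stabilizer G u) hu hx fun g hg hgx =>
    h.eq_one_or_eq hux ht hu hx hg hgx
  rw [h.card_stabilizer] at this
  omega

/-- An element of order `q` that fixes `u` permutes any block containing `u`, with `u` as its only
fixed point there. -/
theorem ncard_block_mod {B : Set X} (hB : MulAction.IsBlock G B) {u : X} (hu : u ∈ B) :
    B.ncard ≡ 1 [MOD (2 * P + 1)] := by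
  have := h.finite
  have : Fact (2 * P + 1).Prime := ⟨h.prime⟩
  obtain ⟨e⟩ := h.stabilizer_equiv u
  obtain ⟨c, hcu, hc⟩ := exists_orderOf_of_dihedral e
  have hcB : c ∈ MulAction.stabilizer G B := hB.stabilizer_le hu hcu
  let C : Subgroup (MulAction.stabilizer G B) := Subgroup.zpowers ⟨c, hcB⟩
  have hC : IsPGroup (2 * P + 1) C := IsPGroup.of_card (n := 1) (by
    rw [Nat.card_zpowers, Subgroup.orderOf_mk, hc, pow_one])
  have hfix : MulAction.fixedPoints C B = {⟨u, hu⟩} := by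
    ext ⟨v, hv⟩
    rw [MulAction.mem_fixedPoints, Set.mem_singleton_iff, Subtype.mk.injEq]
    constructor
    · intro hfix
      have hcv : c • v = v := congrArg Subtype.val (hfix ⟨⟨c, hcB⟩, Subgroup.mem_zpowers _⟩)
      by_contra hne
      obtain ⟨t, ht, htuv⟩ := h.pairStabilizer_eq hne
      have hct : c ∈ pairStabilizer G v u := mem_pairStabilizer.2 ⟨hcv, hcu⟩
      have hP := h.two_le
      rw [htuv, mem_zpowers_iff_of_orderOf_eq_two ht] at hct
      rcases hct with rfl | rfl
      · rw [orderOf_one] at hc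
        omega
      · rw [ht] at hc
        omega
    · rintro rfl ⟨⟨g, hg⟩, hgC⟩
      apply Subtype.ext
      have hgc : g ∈ Subgroup.zpowers c := by
        obtain ⟨k, hk⟩ := hgC
        exact ⟨k, congrArg Subtype.val hk⟩
      exact (Subgroup.zpowers_le.2 hcu) hgc
  have := hC.card_modEq_card_fixedPoints B
  rwa [Nat.card_coe_set_eq, hfix, Nat.card_coe_set_eq, Set.ncard_singleton] at this

theorem isPreprimitive : MulAction.IsPreprimitive G X := by
  have := h.finite
  have := h.pretransitive
  have hP := h.two_le
  obtain ⟨u⟩ := h.nonempty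
  refine MulAction.IsPreprimitive.of_isTrivialBlock_base u fun {B} hu hB => ?_
  have h1 := h.ncard_block_mod hB hu
  have h2 := hB.ncard_block_mul_ncard_orbit_eq ⟨u, hu⟩
  rw [h.card_eq] at h2
  generalize (MulAction.orbit G B).ncard = m at h2
  by_cases hB1 : B.ncard = 1
  · exact Or.inl (Set.ncard_le_one_iff_subsingleton.1 hB1.le)
  by_cases hm1 : m = 1
  · right
    rw [Set.eq_univ_iff_ncard, ← mul_one B.ncard, ← hm1, h2, h.card_eq]
  -- Otherwise `B.ncard` and `m`, both `1` modulo `q`, are at least `q + 1`, which contradicts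
  -- `B.ncard * m = P * (2 * P - 1)`.
  exfalso
  have hpos : 0 < P * (2 * P - 1) := Nat.mul_pos (by omega) (by omega)
  have hmpos : 0 < m := Nat.pos_of_ne_zero fun h0 => by
    rw [h0, mul_zero] at h2
    omega
  have hBpos : 0 < B.ncard := Nat.pos_of_ne_zero fun h0 => by
    rw [h0, zero_mul] at h2
    omega
  obtain ⟨k, hk⟩ := (Nat.modEq_iff_dvd' hBpos).1 h1.symm
  obtain ⟨p, rfl⟩ : ∃ p, P = p + 1 := ⟨P - 1, by omega⟩
  have hm : m ≡ 1 [MOD (2 * (p + 1) + 1)] := by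
    have h3 : 2 * m ≡ 2 * 1 [MOD (2 * (p + 1) + 1)] := by
      calc 2 * m = 2 * (1 * m) := by rw [one_mul]
        _ ≡ 2 * (B.ncard * m) [MOD (2 * (p + 1) + 1)] := (h1.symm.mul_right m).mul_left 2
        _ = 2 * 1 + (2 * (p + 1) + 1) * (2 * p) := by
          rw [h2, show 2 * (p + 1) - 1 = 2 * p + 1 by omega]
          ring
        _ ≡ 2 * 1 [MOD (2 * (p + 1) + 1)] := by
          simp [Nat.ModEq]
    exact Nat.ModEq.cancel_left_of_coprime
      (Nat.coprime_two_right.2 (odd_two_mul_add_one _)) h3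
  obtain ⟨j, hj⟩ := (Nat.modEq_iff_dvd' hmpos).1 hm.symm
  have hk0 : k ≠ 0 := by rintro rfl; omega
  have hj0 : j ≠ 0 := by rintro rfl; omega
  have hB2 : 2 * (p + 1) + 1 ≤ B.ncard := by
    have := Nat.le_mul_of_pos_right (2 * (p + 1) + 1) (Nat.pos_of_ne_zero hk0)
    omega
  have hm2 : 2 * (p + 1) + 1 ≤ m := by
    have := Nat.le_mul_of_pos_right (2 * (p + 1) + 1) (Nat.pos_of_ne_zero hj0)
    omega
  have := Nat.mul_le_mul hB2 hm2
  rw [h2, show 2 * (p + 1) - 1 = 2 * p + 1 by omega] at this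
  nlinarith

theorem faithfulSMul : FaithfulSMul G X := by
  have hP := h.two_le
  refine ⟨fun {g k} hgk => ?_⟩
  have hfix (x : X) : (k⁻¹ * g) • x = x := by rw [mul_smul, hgk, inv_smul_smul]
  generalize hs : k⁻¹ * g = s at hfix
  suffices s = 1 by rwa [this, inv_mul_eq_one, eq_comm] at hs
  have := h.finite
  have : Nontrivial X := by
    rw [← Finite.one_lt_card_iff_nontrivial, h.card_eq]
    exact Nat.lt_of_lt_of_le (show 1 < 2 * 3 by norm_num) (Nat.mul_le_mul hP (by omega))
  obtain ⟨u, v, huv⟩ := exists_pair_ne X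
  obtain ⟨t, ht, htuv⟩ := h.pairStabilizer_eq huv
  have hst : s ∈ pairStabilizer G u v := mem_pairStabilizer.2 ⟨hfix u, hfix v⟩
  rw [htuv, mem_zpowers_iff_of_orderOf_eq_two ht] at hst
  refine hst.resolve_right ?_
  rintro rfl
  have h1 := h.ncard_fixedBy ht
  rw [show MulAction.fixedBy X s = Set.univ from Set.eq_univ_of_forall hfix, Set.ncard_univ,
    h.card_eq] at h1
  have := Nat.mul_le_mul_left P (show 3 ≤ 2 * P - 1 by omega)
  omega

theorem isExtremelyPrimitive : IsExtremelyPrimitive G X := by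
  refine ⟨h.finite, h.faithfulSMul, h.isPreprimitive, fun u hu => ?_, fun u x => ?_⟩
  · have := h.card_stabilizer u
    rw [hu, Subgroup.card_bot] at this
    omega
  · by_cases hux : u = x
    · subst hux
      have : Subsingleton (MulAction.orbit (MulAction.stabilizer G u) u) := by
        refine ⟨?_⟩
        rintro ⟨_, g, rfl⟩ ⟨_, k, rfl⟩
        exact Subtype.ext (g.2.trans (Eq.symm k.2))
      exact MulAction.IsPreprimitive.of_subsingleton
    · apply MulAction.IsPreprimitive.of_prime_card
      rw [Nat.card_coe_set_eq, h.ncard_orbit hux]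
      exact h.prime

/-! ### The group induced on a line -/

theorem smul_fixedBy_eq_iff {t : G} (ht : orderOf t = 2) {g : G} :
    g • MulAction.fixedBy X t = MulAction.fixedBy X t ↔ Commute g t := by
  rw [MulAction.smul_fixedBy]
  constructor
  · intro hg
    obtain ⟨u, v, huv, hu, hv⟩ := h.exists_ne_mem_fixedBy ht
    have hu' : u ∈ MulAction.fixedBy X (g * t * g⁻¹) := hg ▸ hu
    have hv' : v ∈ MulAction.fixedBy X (g * t * g⁻¹) := hg ▸ hv
    exact mul_inv_eq_iff_eq_mul.1 (h.eq_of_fix huv ht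
      ((MulEquiv.orderOf_eq (MulAut.conj g) t).trans ht) hu hv hu' hv')
  · intro hg
    rw [mul_inv_eq_iff_eq_mul.2 hg.eq]

theorem isRegularPermGroup_inducedGroup {l : Set X} (hl : l ∈ lsLines G X) :
    IsRegularPermGroup (inducedGroup G l) := by
  obtain ⟨t, ht, rfl⟩ := h.mem_lsLines_iff.1 hl
  constructor
  · refine ⟨?_⟩
    rintro ⟨x, hx⟩ ⟨y, hy⟩
    rw [h.fixedBy_eq_orbit ht hx] at hy
    obtain ⟨⟨g, hg⟩, rfl⟩ := hy
    have hgl := (h.smul_fixedBy_eq_iff ht).2 (Subgroup.mem_centralizer_singleton_iff.1 hg)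
    exact ⟨⟨_, ⟨⟨g, hgl⟩, rfl⟩⟩, rfl⟩
  · rintro ⟨x, hx⟩
    rw [Subgroup.eq_bot_iff_forall]
    rintro ⟨σ, hσ⟩ hfix
    obtain ⟨g, hgl, hg⟩ := mem_inducedGroup.1 hσ
    have hgx : g • x = x := (hg ⟨x, hx⟩).symm.trans (congrArg Subtype.val hfix)
    apply Subtype.ext
    apply Equiv.ext
    rintro ⟨y, hy⟩
    apply Subtype.ext
    rw [hg]
    rcases h.eq_one_or_eq_of_commute ht hx hgx ((h.smul_fixedBy_eq_iff ht).1 hgl) with rfl | rfl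
    · exact one_smul _ y
    · exact hy

theorem sq_eq_one_of_mem_inducedGroup {l : Set X} (hl : l ∈ lsLines G X)
    {σ : Equiv.Perm l} (hσ : σ ∈ inducedGroup G l) : σ ^ 2 = 1 := by
  obtain ⟨t, ht, rfl⟩ := h.mem_lsLines_iff.1 hl
  obtain ⟨g, hgl, hg⟩ := mem_inducedGroup.1 hσ
  have := h.tori.sq_eq_one_of_commute ht ((h.smul_fixedBy_eq_iff ht).1 hgl)
  apply Equiv.ext
  intro x
  apply Subtype.ext
  rw [sq, Equiv.Perm.mul_apply, hg, hg, ← mul_smul, ← sq, this, one_smul]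
  rfl

end IsTorusAction

/-- The orbit map of a regular permutation group. -/
theorem IsRegularPermGroup.bijective_apply {Y : Type*} {B : Subgroup (Equiv.Perm Y)}
    (hB : IsRegularPermGroup B) (y : Y) :
    Function.Bijective (fun b : B => (b : Equiv.Perm Y) y) := by
  obtain ⟨h1, h2⟩ := hB
  constructor
  · intro b b' hbb'
    have : b'⁻¹ * b ∈ MulAction.stabilizer B y := by
      rw [MulAction.mem_stabilizer_iff, mul_smul, inv_smul_eq_iff]
      exact hbb'
    rw [h2, Subgroup.mem_bot, inv_mul_eq_one] at this
    exact this.symm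
  · intro z
    obtain ⟨b, hb⟩ := MulAction.exists_smul_eq B y z
    exact ⟨b, hb⟩

theorem IsRegularPermGroup.exists_equiv_map_eq_translations {Y F : Type*} [Field F]
    {B : Subgroup (Equiv.Perm Y)} (hB : IsRegularPermGroup B) (φ : B ≃* Multiplicative F) (y : Y) :
    ∃ f : Y ≃ F, B.map f.permCongrHom.toMonoidHom = translations F := by
  let o : B ≃ Y := Equiv.ofBijective _ (hB.bijective_apply y)
  let f : Y ≃ F := o.symm.trans (φ.toEquiv.trans Multiplicative.toAdd)
  have hf (b : B) : f ((b : Equiv.Perm Y) y) = (φ b).toAdd := by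
    change (φ (o.symm (o b))).toAdd = _
    rw [Equiv.symm_apply_apply]
  have key (b : B) (x : F) : f ((b : Equiv.Perm Y) (f.symm x)) = x + (φ b).toAdd := by
    obtain ⟨b', hb'⟩ := (hB.bijective_apply y).2 (f.symm x)
    dsimp only at hb'
    have hx : x = (φ b').toAdd := by rw [← hf, hb', Equiv.apply_symm_apply]
    rw [← hb', ← Equiv.Perm.mul_apply, ← Subgroup.coe_mul, hf, map_mul, toAdd_mul, hx, add_comm]
  refine ⟨f, ?_⟩
  ext τ
  constructor
  · rintro ⟨b, hb, rfl⟩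
    exact ⟨(φ ⟨b, hb⟩).toAdd, fun x => key ⟨b, hb⟩ x⟩
  · rintro ⟨a, ha⟩
    refine ⟨φ.symm (Multiplicative.ofAdd a), Subtype.prop _, Equiv.ext fun x => ?_⟩
    rw [ha]
    refine (key _ x).trans ?_
    rw [MulEquiv.apply_symm_apply, toAdd_ofAdd]

/-! ### The spaces obtained by refining each line of `LS(G)` -/

section Construction

variable {G X : Type*} [Group G] [MulAction G X]

theorem smul_mem_constructionLines {l : Set X} {TL : Set (Set l)} (g : G) {m : Set X}
    (hm : m ∈ constructionLines G l TL) : g • m ∈ constructionLines G l TL := by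
  obtain ⟨t, ht, k, rfl⟩ := hm
  exact ⟨t, ht, g * k, smul_smul g k _⟩

theorem IsRefinement.isTransverse {L L' : Set (Set X)} (h : IsRefinement L' L)
    (hL : IsTransverse G L) : IsTransverse G L' := by
  intro m hm u hu x
  obtain ⟨l, hl, hml⟩ := h m hm
  exact (hL l hl u (hml hu) x).anti (Set.inter_subset_inter_left _ hml)

theorem isRefinement_constructionLines {l : Set X} (hl : l ∈ lsLines G X) (TL : Set (Set l)) :
    IsRefinement (constructionLines G l TL) (lsLines G X) := by
  rintro _ ⟨t, -, g, rfl⟩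
  exact ⟨g • l, smul_mem_lsLines g hl, Set.smul_set_mono (Subtype.coe_image_subset l t)⟩

theorem ncard_constructionLines {l : Set X} {TL : Set (Set l)} {k : ℕ}
    (hk : ∀ t ∈ TL, t.ncard = k) {m : Set X}
    (hm : m ∈ constructionLines G l TL) : m.ncard = k := by
  obtain ⟨t, ht, g, rfl⟩ := hm
  rw [Set.ncard_smul_set, Set.ncard_image_of_injective _ Subtype.val_injective, hk t ht]

end Construction

namespace IsTorusAction

variable {G X : Type*} [Group G] [MulAction G X] {P : ℕ} (h : IsTorusAction G X P)
  {l : Set X} (hl : l ∈ lsLines G X) {TL : Set (Set l)}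

include h hl

theorem isLinearSpace_constructionLines (hT : IsLinearSpace TL)
    (hinv : ∀ σ ∈ inducedGroup G l, ∀ t ∈ TL, σ '' t ∈ TL) :
    IsLinearSpace (constructionLines G l TL) := by
  intro u v huv
  obtain ⟨l', ⟨hl', hu, hv⟩, -⟩ := h.isLinearSpace u v huv
  obtain ⟨g, rfl⟩ := h.isLineTransitive l hl l' hl'
  have hu' := Set.mem_smul_set_iff_inv_smul_mem.1 hu
  have hv' := Set.mem_smul_set_iff_inv_smul_mem.1 hv
  have hne : g⁻¹ • u ≠ g⁻¹ • v := (MulAction.injective g⁻¹).ne huv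
  obtain ⟨t, ⟨ht, hut, hvt⟩, huniq⟩ := hT ⟨_, hu'⟩ ⟨_, hv'⟩ (fun h => hne (congrArg Subtype.val h))
  refine ⟨g • (Subtype.val '' t : Set X), ⟨⟨t, ht, g, rfl⟩,
    Set.mem_smul_set_iff_inv_smul_mem.2 ⟨_, hut, rfl⟩,
    Set.mem_smul_set_iff_inv_smul_mem.2 ⟨_, hvt, rfl⟩⟩, ?_⟩
  rintro _ ⟨⟨t', ht', k, rfl⟩, hu2, hv2⟩
  have hsub : k • (Subtype.val '' t' : Set X) ⊆ k • l :=
    Set.smul_set_mono (Subtype.coe_image_subset l t')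
  have hkl : k • l = g • l := h.isLinearSpace.eq_of_mem huv (smul_mem_lsLines k hl) hl'
    (hsub hu2) (hsub hv2) hu hv
  have hgk : (g⁻¹ * k) • l = l := by rw [mul_smul, hkl, inv_smul_smul]
  let σ : Equiv.Perm l := MulAction.toPermHom (MulAction.stabilizer G l) l ⟨g⁻¹ * k, hgk⟩
  have hσ : ∀ x : l, (σ x : X) = (g⁻¹ * k) • (x : X) := fun _ => rfl
  have himg : (Subtype.val '' (σ '' t') : Set X) = g⁻¹ • k • (Subtype.val '' t' : Set X) := by
    rw [coe_image_inducedGroup hσ, mul_smul]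
  have hmem (w : X) (hw : w ∈ k • (Subtype.val '' t' : Set X)) (hwl : g⁻¹ • w ∈ l) :
      (⟨g⁻¹ • w, hwl⟩ : l) ∈ σ '' t' := by
    have : g⁻¹ • w ∈ (Subtype.val '' (σ '' t') : Set X) := himg ▸ Set.smul_mem_smul_set hw
    obtain ⟨x, hx, hxw⟩ := this
    rwa [← (Subtype.ext hxw : x = ⟨g⁻¹ • w, hwl⟩)]
  have := huniq (σ '' t') ⟨hinv σ (mem_inducedGroup.2 ⟨_, hgk, hσ⟩) t' ht', hmem u hu2 hu',
    hmem v hv2 hv'⟩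
  rw [← this, himg, smul_inv_smul]

end IsTorusAction

namespace IsTorusAction

variable {G X : Type*} [Group G] [MulAction G X] {P : ℕ} (h : IsTorusAction G X P)
  {R : Set (Set X)} (hR : IsRefinement R (lsLines G X)) (hnt : ∀ m ∈ R, m.Nontrivial)

include h hR hnt

/-- The stabiliser in `G_u` of a line `m` through `u` is generated by the involution that fixes
pointwise the line of `LS(G)` containing `m`. -/
theorem ncard_orbit_line {m : Set X} (hm : m ∈ R) {u : X} (hu : u ∈ m) :
    (MulAction.orbit (MulAction.stabilizer G u) m).ncard = 2 * P + 1 := by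
  obtain ⟨l, hl, hml⟩ := hR m hm
  obtain ⟨t, ht, rfl⟩ := h.mem_lsLines_iff.1 hl
  have htm : t • m = m := by
    ext x
    rw [Set.mem_smul_set]
    constructor
    · rintro ⟨y, hy, rfl⟩
      rwa [hml hy]
    · intro hx
      exact ⟨x, hx, hml hx⟩
  obtain ⟨x, hx, hxu⟩ := (hnt m hm).exists_ne u
  have := ncard_orbit_mul_two ht (K := MulAction.stabilizer G u) (hml hu) htm fun g hg hgm =>
    h.eq_one_or_eq_of_smul_mem ht hxu.symm (hml hu) (hml hx) hg
      (hml (hgm ▸ Set.smul_mem_smul_set hx))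
  rw [h.card_stabilizer] at this
  omega

theorem ncard_orbits_mul (hact : ActsOnSpace G R) (u : X) :
    {o : Set (Set X) | ∃ m ∈ R, u ∈ m ∧ o = MulAction.orbit (MulAction.stabilizer G u) m}.ncard *
      (2 * P + 1) = {m ∈ R | u ∈ m}.ncard := by
  have := h.finite
  have hact := actsOnSpace_iff.1 hact
  rw [← mul_one {m ∈ R | u ∈ m}.ncard]
  refine Set.ncard_mul_eq_ncard_mul (Set.toFinite _) (Set.toFinite _) (fun o m => m ∈ o) ?_ ?_
  · rintro _ ⟨m, hm, hu, rfl⟩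
    rw [← h.ncard_orbit_line hR hnt hm hu]
    congr 1
    ext m'
    refine ⟨fun hm' => hm'.2, fun hm' => ⟨?_, hm'⟩⟩
    obtain ⟨g, rfl⟩ := hm'
    refine ⟨hact g m hm, ?_⟩
    have : (g : G) • u ∈ (g : G) • m := Set.smul_mem_smul_set hu
    rwa [g.2] at this
  · rintro m ⟨hm, hu⟩
    rw [Set.ncard_eq_one]
    refine ⟨MulAction.orbit (MulAction.stabilizer G u) m, Set.eq_singleton_iff_unique_mem.2
      ⟨⟨⟨m, hm, hu, rfl⟩, MulAction.mem_orbit_self m⟩, ?_⟩⟩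
    rintro _ ⟨⟨m', hm', hu', rfl⟩, hmm'⟩
    exact (MulAction.orbit_eq_iff.2 hmm').symm

end IsTorusAction

theorem IsLineTransitive.ncard_le {G X : Type*} [Group G] [Finite G] [MulAction G X]
    {L : Set (Set X)} (h : IsLineTransitive G L) : L.ncard ≤ Nat.card G := by
  rcases L.eq_empty_or_nonempty with rfl | ⟨l, hl⟩
  · simp
  · have hsub : L ⊆ Set.range (fun g : G => g • l) := fun l' hl' => h l hl l' hl'
    refine (Set.ncard_le_ncard hsub (Set.finite_range _)).trans ?_
    rw [← Set.image_univ, ← Set.ncard_univ G]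
    exact Set.ncard_image_le

section WBS

/-- The number of involutions of a finite group of even order is odd. -/
theorem odd_ncard_orderOf_eq_two {G : Type*} [Group G] [Finite G] (hG : Even (Nat.card G)) :
    Odd {g : G | orderOf g = 2}.ncard := by
  classical
  have : Fintype G := Fintype.ofFinite G
  have : Fact (Nat.Prime 2) := ⟨Nat.prime_two⟩
  have h1 := Equiv.Perm.card_fixedPoints_modEq (f := fun g : G => g⁻¹) (p := 2) (n := 1)
    (funext fun g => inv_inv g)
  have h2 : Function.fixedPoints (fun g : G => g⁻¹) = insert 1 {g : G | orderOf g = 2} := by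
    ext g
    rw [Function.mem_fixedPoints, Function.IsFixedPt, inv_eq_iff_mul_eq_one, ← sq,
      Set.mem_insert_iff, Set.mem_ofPred_eq, orderOf_eq_prime_iff]
    constructor
    · intro h
      exact or_iff_not_imp_left.2 fun hne => ⟨h, hne⟩
    · rintro (rfl | ⟨h, -⟩)
      · exact one_pow 2
      · exact h
  have h3 : Fintype.card (Function.fixedPoints (fun g : G => g⁻¹)) =
      {g : G | orderOf g = 2}.ncard + 1 := by
    rw [← Nat.card_eq_fintype_card, Nat.card_coe_set_eq, h2, Set.ncard_insert_of_notMem]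
    simp
  rw [h3, ← Nat.card_eq_fintype_card] at h1
  rw [← Nat.not_even_iff_odd]
  rw [Nat.even_iff] at *
  unfold Nat.ModEq at h1
  omega

theorem ncard_orderOf_eq_two_of_dihedral {G : Type*} [Group G] {n : ℕ} (hn : Odd n) {D : Subgroup G}
    (e : D ≃* DihedralGroup n) : {g : G | orderOf g = 2 ∧ g ∈ D}.ncard = n := by
  have : {g : G | orderOf g = 2 ∧ g ∈ D} =
      Set.range (fun i : ZMod n => (e.symm (DihedralGroup.sr i) : G)) := by
    ext g
    constructor
    · rintro ⟨hg, hgD⟩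
      obtain ⟨i, hi⟩ := DihedralGroup.exists_eq_sr_of_orderOf_eq_two hn (x := e ⟨g, hgD⟩)
        ((MulEquiv.orderOf_eq _ _).trans ((Subgroup.orderOf_mk _ _).trans hg))
      exact ⟨i, by simp only [← hi, MulEquiv.symm_apply_apply]⟩
    · rintro ⟨i, rfl⟩
      refine ⟨?_, Subtype.prop _⟩
      rw [Subgroup.orderOf_coe, MulEquiv.orderOf_eq, DihedralGroup.orderOf_sr]
  rw [this, ← Nat.card_coe_set_eq, Nat.card_range_of_injective, Nat.card_zmod]
  intro i j hij
  have := e.symm.injective (Subtype.ext hij)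
  simpa using this

/-- The number of pairs of an involution and a dihedral subgroup containing it, counted in two
ways. -/
theorem wbs_count (K : Type*) [Field K] [Finite K] (hK : Even (Nat.card K)) {k : ℕ}
    (hk : ∀ l ∈ wbsLines K, l.ncard = k) :
    {g : PSL(2, K) | orderOf g = 2}.ncard * k = Nat.card (WBSPoint K) * (Nat.card K + 1) := by
  have : Finite PSL(2, K) := inferInstance
  rw [← Set.ncard_univ (WBSPoint K)]
  refine Set.ncard_mul_eq_ncard_mul (Set.toFinite _) (Set.toFinite _) (fun g D => g ∈ D.1) ?_ ?_
  · intro g hg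
    rw [← hk _ ⟨g, hg, rfl⟩]
    congr 1
    ext
    simp
  · rintro ⟨D, ⟨e⟩⟩ -
    exact ncard_orderOf_eq_two_of_dihedral hK.add_one e

end WBS

/-! ### The field of order `2 ^ 15` and its semilinear groups -/

section Field32

variable {F : Type*} [Field F]

/-- The maps that preserve the ratio `s` in which a point divides a pair, for each `s` fixed by
`x ↦ x ^ 32`. -/
def affineMaps32 (F : Type*) [Field F] : Subgroup (Equiv.Perm F) where
  carrier := {f | ∀ x y s : F, s ^ 32 = s → f (x + s * (y - x)) = f x + s * (f y - f x)}
  one_mem' := fun _ _ _ _ => rfl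
  mul_mem' := fun {f g} hf hg x y s hs => by
    simp only [Equiv.Perm.mul_apply, hg x y s hs, hf _ _ s hs]
  inv_mem' := fun {f} hf x y s hs => by
    rw [Equiv.Perm.inv_eq_iff_eq, hf _ _ s hs]
    simp

theorem translations_le_affineMaps32 : translations F ≤ affineMaps32 F := by
  rintro f ⟨b, hb⟩ x y s -
  rw [hb, hb, hb]
  ring

theorem finite_of_card {F : Type*} (hF : Nat.card F = 2 ^ 15) : Finite F :=
  Nat.finite_of_card_ne_zero (by rw [hF]; norm_num)

variable (hF : Nat.card F = 2 ^ 15)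

include hF

theorem pow_card_eq (x : F) : x ^ 2 ^ 15 = x := by
  have := finite_of_card hF
  have := Fintype.ofFinite F
  rw [← hF, Nat.card_eq_fintype_card, FiniteField.pow_card]

theorem pow_32_pow (x : F) (i : ℕ) : x ^ 32 ^ (3 * i) = x := by
  induction i with
  | zero => simp
  | succ i ih =>
    rw [mul_add, pow_add, pow_mul, ih, show 32 ^ (3 * 1) = 2 ^ 15 by norm_num, pow_card_eq hF]

theorem pow_32_mod (x : F) (i : ℕ) : x ^ 32 ^ i = x ^ 32 ^ (i % 3) := by
  conv_lhs => rw [← Nat.div_add_mod i 3, pow_add, pow_mul, pow_32_pow hF]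

theorem card_rootsOfUnity_of_dvd {n m : ℕ} (hnm : n * m = 2 ^ 15 - 1) :
    Nat.card (rootsOfUnity n F) = n := by
  have := finite_of_card hF
  have hn : NeZero n := ⟨by rintro rfl; norm_num at hnm⟩
  obtain ⟨g, hg⟩ := IsCyclic.exists_generator (α := Fˣ)
  have ho : orderOf g = n * m := by
    rw [orderOf_eq_card_of_forall_mem_zpowers hg, Nat.card_units, hF, hnm]
  have hm : m ≠ 0 := by rintro rfl; norm_num at hnm
  have hp : orderOf (g ^ m) = n := by
    rw [orderOf_pow_of_dvd hm ⟨n, by rw [ho, mul_comm]⟩, ho,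
      Nat.mul_div_cancel _ (Nat.pos_of_ne_zero hm)]
  have hprim : IsPrimitiveRoot ((g ^ m : Fˣ) : F) n := by
    rw [IsPrimitiveRoot.coe_units_iff, ← hp]
    exact IsPrimitiveRoot.orderOf _
  exact hprim.card_rootsOfUnity

theorem ncard_pow_32_eq : {s : F | s ^ 32 = s}.ncard = 32 := by
  have := finite_of_card hF
  have h1 : {s : F | s ^ 32 = s} =
      insert 0 (Set.range fun u : rootsOfUnity 31 F => ((u : Fˣ) : F)) := by
    ext s
    rw [Set.mem_ofPred_eq, Set.mem_insert_iff, Set.mem_range]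
    constructor
    · intro hs
      by_cases h0 : s = 0
      · exact Or.inl h0
      · refine Or.inr ⟨⟨Units.mk0 s h0, ?_⟩, rfl⟩
        rw [mem_rootsOfUnity', Units.val_mk0]
        apply mul_right_cancel₀ h0
        rw [← pow_succ, hs, one_mul]
    · rintro (rfl | ⟨⟨u, hu⟩, rfl⟩)
      · simp
      · rw [mem_rootsOfUnity'] at hu
        change (u : F) ^ 32 = u
        rw [pow_succ, hu, one_mul]
  rw [h1, Set.ncard_insert_of_notMem, ← Nat.card_coe_set_eq, Nat.card_range_of_injective,
    card_rootsOfUnity_of_dvd hF (m := 1057) (by norm_num)]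
  · intro u v huv
    exact Subtype.ext (Units.ext huv)
  · rintro ⟨u, hu⟩
    exact u.1.ne_zero hu

/-- The group of the maps `x ↦ a x ^ (32 ^ i)` with `a ^ 1057 = 1`. As `1057 = 1 + 32 + 32 ^ 2`,
this condition says that `a` has norm `1` over the subfield of order `32`. -/
def normOneGroup : Subgroup (Equiv.Perm F) where
  carrier := {f | ∃ (a : F) (i : ℕ), a ^ 1057 = 1 ∧ ∀ x, f x = a * x ^ 32 ^ i}
  one_mem' := ⟨1, 0, by simp⟩
  mul_mem' := by
    rintro f g ⟨a, i, ha, hf⟩ ⟨b, j, hb, hg⟩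
    refine ⟨a * b ^ 32 ^ i, j + i, ?_, fun x => ?_⟩
    · rw [mul_pow, ha, ← pow_mul, mul_comm (32 ^ i), pow_mul, hb, one_pow, one_mul]
    · rw [Equiv.Perm.mul_apply, hg, hf, mul_pow, ← pow_mul, ← pow_add, mul_assoc]
  inv_mem' := by
    rintro f ⟨a, i, ha, hf⟩
    have ha0 : a ≠ 0 := by rintro rfl; norm_num at ha
    refine ⟨a⁻¹ ^ 32 ^ (2 * i), 2 * i, ?_, fun x => ?_⟩
    · rw [← pow_mul, mul_comm (32 ^ (2 * i)), pow_mul, inv_pow, ha, inv_one, one_pow]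
    · rw [Equiv.Perm.inv_eq_iff_eq, hf, ← mul_pow, ← pow_mul, ← pow_add,
        show 2 * i + i = 3 * i by ring, pow_32_pow hF, mul_inv_cancel_left₀ ha0]

theorem normOneGroup_inf_gl1 :
    normOneGroup hF ⊓ gl1 F = (rootsOfUnity 1057 F).map (MulAction.toPermHom Fˣ F) := by
  ext f
  constructor
  · rintro ⟨⟨a, i, ha, hf⟩, u, rfl⟩
    refine ⟨u, ?_, rfl⟩
    have h1 : (u : F) * 1 = a * 1 ^ 32 ^ i := hf 1
    rw [mul_one, one_pow, mul_one] at h1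
    rw [SetLike.mem_coe, mem_rootsOfUnity', h1, ha]
  · rintro ⟨u, hu, rfl⟩
    refine ⟨⟨u, 0, (mem_rootsOfUnity' _ _).1 hu, fun x => ?_⟩, u, rfl⟩
    rw [pow_zero, pow_one]
    rfl

theorem card_map_rootsOfUnity :
    Nat.card ((rootsOfUnity 1057 F).map (MulAction.toPermHom Fˣ F)) = 1057 := by
  rw [Subgroup.card_map_of_injective MulAction.toPerm_injective,
    card_rootsOfUnity_of_dvd hF (m := 31) (by norm_num)]

variable [CharP F 2]

theorem normOneGroup_le_affineMaps32 : normOneGroup hF ≤ affineMaps32 F := by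
  have := finite_of_card hF
  rintro f ⟨a, i, -, hf⟩ x y s hs
  have hsi : s ^ 32 ^ i = s := by
    clear hf
    induction i with
    | zero => simp
    | succ i ih => rw [pow_succ, pow_mul, ih, hs]
  have hadd (x y : F) : (x + y) ^ 32 ^ i = x ^ 32 ^ i + y ^ 32 ^ i := by
    rw [show 32 = 2 ^ 5 by norm_num, ← pow_mul, add_pow_char_pow]
  have hsub (x y : F) : (x - y) ^ 32 ^ i = x ^ 32 ^ i - y ^ 32 ^ i := by
    rw [show 32 = 2 ^ 5 by norm_num, ← pow_mul, sub_pow_char_pow]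
  rw [hf, hf, hf, hadd, mul_pow, hsub, hsi]
  ring

theorem exists_frobenius_pow (σ : F ≃+* F) : ∃ j : ℕ, ∀ x, σ x = x ^ 2 ^ j := by
  have := finite_of_card hF
  let := ZMod.algebra F 2
  let τ : F ≃ₐ[ZMod 2] F := AlgEquiv.ofRingEquiv (f := σ) fun x => by
    exact RingHom.congr_fun (Subsingleton.elim ((σ : F →+* F).comp (algebraMap (ZMod 2) F))
      (algebraMap (ZMod 2) F)) x
  obtain ⟨j, hj⟩ := (FiniteField.bijective_frobeniusAlgEquivOfAlgebraic_pow (ZMod 2) F).2 τ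
  refine ⟨j, fun x => ?_⟩
  have := DFunLike.congr_fun hj x
  rw [AlgEquiv.coe_pow, FiniteField.coe_frobeniusAlgEquivOfAlgebraic_iterate, ZMod.card] at this
  exact this.symm

theorem dvd_of_pow_eq {j : ℕ} (hj : ∀ x : F, x ^ 2 ^ j = x) : 15 ∣ j := by
  have := finite_of_card hF
  let := ZMod.algebra F 2
  have hfin : Module.finrank (ZMod 2) F = 15 := by
    have h1 := Module.natCard_eq_pow_finrank (K := ZMod 2) (V := F)
    rw [hF, Nat.card_zmod] at h1
    exact (Nat.pow_right_injective le_rfl h1).symm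
  rw [← hfin, ← FiniteField.orderOf_frobeniusAlgEquivOfAlgebraic]
  apply orderOf_dvd_of_pow_eq_one
  ext x
  rw [AlgEquiv.coe_pow, FiniteField.coe_frobeniusAlgEquivOfAlgebraic_iterate, ZMod.card]
  exact hj x

/-- The Frobenius automorphism `x ↦ x ^ 32`, as a permutation. -/
theorem exists_frobenius32 : ∃ φ : Equiv.Perm F, ∀ x, φ x = x ^ 32 := by
  have := finite_of_card hF
  exact ⟨(iterateFrobeniusEquiv F 2 5).toEquiv, fun x => rfl⟩

theorem isSemilinearProduct_normOneGroup : IsSemilinearProduct (normOneGroup hF) 1057 3 := by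
  have := finite_of_card hF
  obtain ⟨φ, hφ⟩ := exists_frobenius32 hF
  have hφk (k : ℕ) (x : F) : (φ ^ k) x = x ^ 32 ^ k := by
    induction k with
    | zero => simp
    | succ k ih => rw [pow_succ', Equiv.Perm.mul_apply, ih, hφ, ← pow_mul, pow_succ]
  have hφ3 : φ ^ 3 = 1 := Equiv.ext fun x => by
    rw [hφk, ← mul_one 3, pow_32_pow hF]
    rfl
  have hφ1 : φ ≠ 1 := by
    intro h
    have h32 : {s : F | s ^ 32 = s} = Set.univ := Set.eq_univ_of_forall fun x => by
      rw [Set.mem_ofPred_eq, ← hφ, h]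
      rfl
    have := ncard_pow_32_eq hF
    rw [h32, Set.ncard_univ, hF] at this
    norm_num at this
  have hord : orderOf φ = 3 := orderOf_eq_prime hφ3 hφ1
  have hz (f : Equiv.Perm F) (hf : f ∈ Subgroup.zpowers φ) : ∃ k : ℕ, ∀ x, f x = x ^ 32 ^ k := by
    obtain ⟨k, rfl⟩ := mem_powers_iff_mem_zpowers.2 hf
    exact ⟨k, hφk k⟩
  refine ⟨?_, ?_, Subgroup.zpowers φ, inferInstance, ?_, ?_, ?_⟩
  · rintro f ⟨a, i, ha, hf⟩
    have ha0 : a ≠ 0 := by rintro rfl; norm_num at ha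
    refine ⟨Units.mk0 a ha0, iterateFrobeniusEquiv F 2 (5 * i), fun x => ?_⟩
    rw [hf, iterateFrobeniusEquiv_def, pow_mul]
    rfl
  · rw [normOneGroup_inf_gl1, card_map_rootsOfUnity hF]
  · rw [Nat.card_zpowers, hord]
  · rw [eq_bot_iff]
    rintro f ⟨⟨-, u, rfl⟩, hu⟩
    obtain ⟨k, hk⟩ := hz _ hu
    have h1 : (u : F) * 1 = 1 ^ 32 ^ k := hk 1
    rw [mul_one, one_pow, Units.val_eq_one] at h1
    rw [h1, map_one]
    exact one_mem _
  · apply le_antisymm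
    · refine sup_le inf_le_left (Subgroup.zpowers_le.2 ⟨1, 1, one_pow _, fun x => ?_⟩)
      rw [hφ, pow_one, one_mul]
    · rintro f ⟨a, i, ha, hf⟩
      have ha0 : a ≠ 0 := by rintro rfl; norm_num at ha
      have hfa : f = MulAction.toPermHom Fˣ F (Units.mk0 a ha0) * φ ^ i := Equiv.ext fun x => by
        rw [Equiv.Perm.mul_apply, hφk, hf]
        rfl
      rw [hfa]
      refine mul_mem (Subgroup.mem_sup_left ?_) (Subgroup.mem_sup_right
        (pow_mem (Subgroup.mem_zpowers φ) i))
      rw [normOneGroup_inf_gl1]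
      exact ⟨_, (mem_rootsOfUnity' _ _).2 ha, rfl⟩

/-- The subgroup of order `1057` of the cyclic group `F^×` is unique. A generator `x ↦ a σ(x)` of
the complement has order three and is not in `GL₁`, so `σ` has order three, that is,
`σ(x) = x ^ (32 ^ i)` with `i` equal to `1` or `2`. The cube of the generator being `1` then says
that `a` has norm one. -/
theorem IsSemilinearProduct.eq_normOneGroup {H : Subgroup (Equiv.Perm F)}
    (hH : IsSemilinearProduct H 1057 3) : H = normOneGroup hF := by
  have := finite_of_card hF
  obtain ⟨hle, hcard, E, -, hE, hinf, hsup⟩ := hH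
  have hC : H ⊓ gl1 F = (rootsOfUnity 1057 F).map (MulAction.toPermHom Fˣ F) := by
    apply Subgroup.eq_of_le_of_card_ge
    · rintro _ ⟨hu, u, rfl⟩
      refine ⟨u, ?_, rfl⟩
      have h1 :
          (⟨MulAction.toPermHom Fˣ F u, hu, u, rfl⟩ : (H ⊓ gl1 F : Subgroup _)) ^ 1057 = 1 := by
        rw [← hcard, pow_card_eq_one']
      have h2 : MulAction.toPermHom Fˣ F (u ^ 1057) = 1 := by
        have h2 := congrArg Subtype.val h1
        rw [Subgroup.coe_pow, Subgroup.coe_one] at h2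
        rw [map_pow]
        exact h2
      rw [SetLike.mem_coe, mem_rootsOfUnity]
      have hinj : Function.Injective (MulAction.toPermHom Fˣ F) := MulAction.toPerm_injective
      exact hinj (h2.trans (map_one _).symm)
    · rw [card_map_rootsOfUnity hF, hcard]
  have hmul (a : F) (ha : a ^ 1057 = 1) : ∃ f ∈ H ⊓ gl1 F, ∀ x, f x = a * x := by
    have ha0 : a ≠ 0 := by rintro rfl; norm_num at ha
    rw [hC]
    exact ⟨_, ⟨Units.mk0 a ha0, (mem_rootsOfUnity' _ _).2 ha, rfl⟩, fun x => rfl⟩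
  -- The nontrivial elements of the complement have the form `x ↦ a x ^ (32 ^ i)`, not in `GL₁`.
  have key : ∀ f ∈ E, f ≠ 1 → ∃ (a : F) (i : ℕ), a ^ 1057 = 1 ∧ (i % 3 = 1 ∨ i % 3 = 2) ∧
      ∀ x, f x = a * x ^ 32 ^ i := by
    intro f hf hf1
    obtain ⟨a, σ, hfa⟩ := hle (hsup ▸ Subgroup.mem_sup_right hf)
    have hf3 : f ^ 3 = 1 := by
      have h1 : (⟨f, hf⟩ : E) ^ 3 = 1 := by rw [← hE, pow_card_eq_one']
      exact congrArg Subtype.val h1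
    have hf3x (x : F) : f (f (f x)) = x := congrArg (fun g : Equiv.Perm F => g x) hf3
    have h1 : (a : F) * (σ a * σ (σ a)) = 1 := by
      have := hf3x 1
      simpa [hfa] using this
    have hσ3 (x : F) : σ (σ (σ x)) = x := by
      have := hf3x x
      simp only [hfa, map_mul] at this
      calc σ (σ (σ x)) = ((a : F) * (σ a * σ (σ a))) * σ (σ (σ x)) := by rw [h1, one_mul]
        _ = x := by
          rw [mul_assoc, mul_assoc]
          exact this
    obtain ⟨j, hj⟩ := exists_frobenius_pow hF σ
    have h15 : 15 ∣ j + (j + j) := by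
      apply dvd_of_pow_eq hF
      intro x
      have := hσ3 x
      rwa [hj (σ (σ x)), hj (σ x), hj x, ← pow_mul, ← pow_mul, ← pow_add, ← pow_add] at this
    obtain ⟨i, rfl⟩ : ∃ i, j = 5 * i := ⟨j / 5, by omega⟩
    have hσ (x : F) : σ x = x ^ 32 ^ (i % 3) := by
      rw [← pow_32_mod hF, hj, pow_mul, show (2 : ℕ) ^ 5 = 32 by norm_num]
    have hi : i % 3 = 1 ∨ i % 3 = 2 := by
      by_contra! hi
      have hi0 : i % 3 = 0 := by omega
      apply hf1
      rw [← Subgroup.mem_bot, ← hinf]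
      refine ⟨⟨hsup ▸ Subgroup.mem_sup_right hf, a, Equiv.ext fun x => ?_⟩, hf⟩
      rw [hfa, hσ, hi0, pow_zero, pow_one]
      rfl
    refine ⟨a, i, ?_, hi, fun x => by rw [hfa, hσ, ← pow_32_mod hF]⟩
    rw [hσ (σ a), hσ a] at h1
    rcases hi with hi | hi
    · rw [hi, pow_one, ← pow_mul] at h1
      rw [← h1]
      ring
    · have h4 : ((a : F) ^ 32 ^ 2) ^ 32 ^ 2 = a ^ 32 := by
        rw [← pow_mul, ← pow_add, pow_32_mod hF]
        norm_num
      rw [hi, h4] at h1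
      rw [← h1]
      ring
  apply le_antisymm
  · rw [← hsup]
    refine sup_le ?_ fun f hf => ?_
    · rw [hC, ← normOneGroup_inf_gl1 hF]
      exact inf_le_left
    · by_cases hf1 : f = 1
      · exact hf1 ▸ one_mem _
      · obtain ⟨a, i, ha, -, hfa⟩ := key f hf hf1
        exact ⟨a, i, ha, hfa⟩
  · obtain ⟨φ, hφH, hφ⟩ : ∃ φ ∈ H, ∀ x, φ x = x ^ 32 := by
      have : Nontrivial E := by
        rw [← Finite.one_lt_card_iff_nontrivial, hE]
        norm_num
      obtain ⟨⟨f, hf⟩, hne⟩ := exists_ne (1 : E)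
      obtain ⟨a, i, ha, hi, hfa⟩ := key f hf fun h => hne (Subtype.ext h)
      obtain ⟨g, hg, hga⟩ := hmul a ha
      have hσ (x : F) : (g⁻¹ * f) x = x ^ 32 ^ i := by
        rw [Equiv.Perm.mul_apply, Equiv.Perm.inv_eq_iff_eq, hga, hfa]
      have hσk (k : ℕ) (x : F) : ((g⁻¹ * f) ^ k) x = x ^ 32 ^ (i * k) := by
        induction k with
        | zero => simp
        | succ k ih =>
          rw [pow_succ', Equiv.Perm.mul_apply, ih, hσ, ← pow_mul, ← pow_add, mul_add_one]
      refine ⟨(g⁻¹ * f) ^ i, H.pow_mem (H.mul_mem (H.inv_mem hg.1)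
        (hsup ▸ Subgroup.mem_sup_right hf)) i, fun x => ?_⟩
      have hii : i * i % 3 = 1 := by
        rcases hi with hi | hi <;> rw [Nat.mul_mod, hi]
      rw [hσk, pow_32_mod hF, hii, pow_one]
    rintro f ⟨a, i, ha, hf⟩
    obtain ⟨g, hg, hga⟩ := hmul a ha
    have hφk (k : ℕ) (x : F) : (φ ^ k) x = x ^ 32 ^ k := by
      induction k with
      | zero => simp
      | succ k ih => rw [pow_succ', Equiv.Perm.mul_apply, ih, hφ, ← pow_mul, pow_succ]
    have hfg : f = g * φ ^ i := Equiv.ext fun x => by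
      rw [Equiv.Perm.mul_apply, hφk, hga, hf]
    rw [hfg]
    exact mul_mem hg.1 (pow_mem hφH i)

/-! ### The affine space over the subfield of order 32 -/

/-- The set `Λ_{uv}` is the line through `u` and `v` of the affine space over the subfield of order
`32`. -/
theorem pairStabilizer_le_iff {u v w : F} (huv : u ≠ v) :
    pairStabilizer (affineGroup (normOneGroup hF)) u v ≤
        MulAction.stabilizer (affineGroup (normOneGroup hF)) w ↔
      ∃ s : F, s ^ 32 = s ∧ w = u + s * (v - u) := by
  have := finite_of_card hF
  have hd : v - u ≠ 0 := sub_ne_zero.2 huv.symm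
  constructor
  · intro h
    have hexists (f : Equiv.Perm F) (hf : f ∈ affineGroup (normOneGroup hF)) (hu : f u = u)
        (hv : f v = v) : f w = w :=
      h (mem_pairStabilizer.2 ⟨hu, hv⟩ : (⟨f, hf⟩ : affineGroup (normOneGroup hF)) ∈ _)
    obtain ⟨φ, hφ⟩ := exists_frobenius32 hF
    -- `a` is chosen so that `x ↦ u + a⁻¹ (x - u) ^ 32` fixes `v`; it has norm one because
    -- `31 * 1057 = 2 ^ 15 - 1`.
    let a : F := (v - u) ^ 31
    have ha0 : a ≠ 0 := pow_ne_zero _ hd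
    have ha : a ^ 1057 = 1 := by
      apply mul_right_cancel₀ hd
      rw [← pow_mul, ← pow_succ, one_mul]
      exact pow_card_eq hF _
    let τ (b : F) : Equiv.Perm F := Equiv.addRight b
    have hτ (b : F) : τ b ∈ affineGroup (normOneGroup hF) :=
      Subgroup.mem_sup_left ⟨b, fun x => rfl⟩
    let g : Equiv.Perm F := MulAction.toPermHom Fˣ F (Units.mk0 a ha0)⁻¹ * φ
    have hgx (x : F) : g x = a⁻¹ * x ^ 32 := by
      rw [← hφ]
      rfl
    have hg : g ∈ affineGroup (normOneGroup hF) :=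
      Subgroup.mem_sup_right ⟨a⁻¹, 1, by rw [inv_pow, ha, inv_one], fun x => by rw [hgx, pow_one]⟩
    have hf (x : F) : (τ u * (g * τ (-u))) x = a⁻¹ * (x + -u) ^ 32 + u := by
      rw [← hgx]
      rfl
    have hw := hexists _ (mul_mem (hτ u) (mul_mem hg (hτ (-u)))) (by rw [hf]; simp)
      (by
        rw [hf, ← sub_eq_add_neg, pow_succ, inv_mul_cancel_left₀ ha0, sub_add_cancel])
    rw [hf, ← sub_eq_add_neg] at hw
    have hw' : (w - u) ^ 32 = a * (w - u) := by
      rw [← eq_sub_iff_add_eq] at hw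
      rw [← mul_inv_cancel_left₀ ha0 ((w - u) ^ 32), hw]
    refine ⟨(w - u) / (v - u), ?_, ?_⟩
    · rw [div_pow, hw', pow_succ (v - u) 31, mul_div_mul_left _ _ ha0]
    · rw [div_mul_cancel₀ _ hd, add_sub_cancel]
  · rintro ⟨s, hs, rfl⟩ ⟨f, hf⟩ hfuv
    obtain ⟨hu, hv⟩ := mem_pairStabilizer.1 hfuv
    have hu : f u = u := hu
    have hv : f v = v := hv
    have hle : affineGroup (normOneGroup hF) ≤ affineMaps32 F :=
      sup_le translations_le_affineMaps32 (normOneGroup_le_affineMaps32 hF)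
    change f (u + s * (v - u)) = _
    rw [hle hf u v s hs, hu, hv]

theorem propertyStar_affineGroup : PropertyStar (affineGroup (normOneGroup hF)) F := by
  intro u v w huw hw
  by_cases huv : u = v
  · subst huv
    exact inf_le_left
  · obtain ⟨s, hs, rfl⟩ := (pairStabilizer_le_iff hF huv).1 hw
    have hs0 : s ≠ 0 := by
      rintro rfl
      simp at huw
    rw [pairStabilizer_le_iff hF huw]
    refine ⟨s⁻¹, by rw [inv_pow, hs], ?_⟩
    rw [add_sub_cancel_left, inv_mul_cancel_left₀ hs0, add_sub_cancel]

theorem ncard_of_mem_lsLines {t : Set F} (ht : t ∈ lsLines (affineGroup (normOneGroup hF)) F) :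
    t.ncard = 32 := by
  obtain ⟨u, v, huv, rfl⟩ := ht
  have hd : v - u ≠ 0 := sub_ne_zero.2 huv.symm
  have : {w : F | pairStabilizer (affineGroup (normOneGroup hF)) u v ≤
      MulAction.stabilizer (affineGroup (normOneGroup hF)) w} =
      (fun s => u + s * (v - u)) '' {s : F | s ^ 32 = s} := by
    ext w
    rw [Set.mem_ofPred_eq, pairStabilizer_le_iff hF huv, Set.mem_image]
    simp only [Set.mem_ofPred_eq, eq_comm]
  rw [this, Set.ncard_image_of_injective, ncard_pow_32_eq hF]
  intro s s' hss'
  exact mul_right_cancel₀ hd (add_left_cancel hss')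

end Field32

theorem le_autGroup_lsLines {P : Type*} (A : Subgroup (Equiv.Perm P)) :
    A ≤ autGroup (lsLines A P) :=
  fun σ hσ => actsOnSpace_lsLines (G := A) (P := P) ⟨⟨σ, hσ⟩, rfl⟩

/-! ### Identifications of a line with the field -/

theorem IsLinearSpace.preimage {Y F : Type*} {L : Set (Set F)} (hL : IsLinearSpace L) (f : Y ≃ F) :
    IsLinearSpace {t : Set Y | f '' t ∈ L} := by
  intro u v huv
  obtain ⟨l, ⟨hl, hu, hv⟩, huniq⟩ := hL (f u) (f v) (f.injective.ne huv)
  refine ⟨f ⁻¹' l, ⟨?_, hu, hv⟩, ?_⟩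
  · rwa [Set.mem_ofPred_eq, f.image_preimage]
  · rintro t ⟨ht, hut, hvt⟩
    rw [← huniq (f '' t) ⟨ht, Set.mem_image_of_mem f hut, Set.mem_image_of_mem f hvt⟩,
      f.preimage_image]

theorem image_mem_of_mem_translations {Y F : Type*} [Field F] {B : Subgroup (Equiv.Perm Y)}
    {H : Subgroup (Equiv.Perm F)} {f : Y ≃ F}
    (hf : B.map f.permCongrHom.toMonoidHom = translations F) :
    ∀ σ ∈ B, ∀ t ∈ {t : Set Y | f '' t ∈ lsLines (affineGroup H) F},
      σ '' t ∈ {t : Set Y | f '' t ∈ lsLines (affineGroup H) F} := by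
  intro σ hσ t ht
  have h1 : f.permCongrHom σ ∈ affineGroup H := by
    apply Subgroup.mem_sup_left
    rw [← hf]
    exact ⟨σ, hσ, rfl⟩
  have h2 := smul_mem_lsLines (⟨_, h1⟩ : affineGroup H) ht
  suffices f '' (σ '' t) = (⟨_, h1⟩ : affineGroup H) • (f '' t) by
    rw [← this] at h2
    exact h2
  ext y
  simp only [Set.mem_image, Set.mem_smul_set, exists_exists_and_eq_and]
  refine exists_congr fun x => and_congr_right fun _ => ?_
  change _ ↔ f (σ (f.symm (f x))) = y
  rw [Equiv.symm_apply_apply]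

namespace IsTorusAction

section

variable {G X : Type*} [Group G] [MulAction G X] {P : ℕ} (h : IsTorusAction G X P)
  {l : Set X} (hl : l ∈ lsLines G X)

include h hl

theorem ncard_line : l.ncard = P := by
  obtain ⟨t, ht, rfl⟩ := h.mem_lsLines_iff.1 hl
  exact h.ncard_fixedBy ht

/-- The group induced on a line is isomorphic to any group of exponent two of the same order. -/
theorem nonempty_inducedGroup_mulEquiv {F : Type*} [AddCommGroup F] [Finite F]
    (hF : ∀ x : F, 2 • x = 0) (hcard : Nat.card F = P) :
    Nonempty (inducedGroup G l ≃* Multiplicative F) := by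
  have := h.finite
  have hP := h.two_le
  have hlP := h.ncard_line hl
  obtain ⟨x, hx⟩ : l.Nonempty := Set.nonempty_of_ncard_ne_zero (by omega)
  refine nonempty_mulEquiv_of_sq_eq_one
    (fun b => Subtype.ext (h.sq_eq_one_of_mem_inducedGroup hl b.2)) hF ?_
  rw [Nat.card_eq_of_bijective _
    ((h.isRegularPermGroup_inducedGroup hl).bijective_apply ⟨x, hx⟩),
    Nat.card_coe_set_eq, hcard, hlP]

theorem exists_equiv_map_inducedGroup {F : Type*} [Field F] [Finite F] [CharP F 2]
    (hcard : Nat.card F = P) :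
    ∃ f : l ≃ F, (inducedGroup G l).map f.permCongrHom.toMonoidHom = translations F := by
  obtain ⟨φ⟩ := h.nonempty_inducedGroup_mulEquiv hl
    (fun x : F => by rw [two_nsmul, CharTwo.add_self_eq_zero]) hcard
  have hP := h.two_le
  have hlP := h.ncard_line hl
  obtain ⟨x, hx⟩ : l.Nonempty := Set.nonempty_of_ncard_ne_zero (by omega)
  exact (h.isRegularPermGroup_inducedGroup hl).exists_equiv_map_eq_translations φ ⟨x, hx⟩

end

theorem exists_wbs_equiv {K : Type*} [Field K] {P : ℕ} {D : Subgroup PSL(2, K)}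
    (h : IsTorusAction PSL(2, K) (PSL(2, K) ⧸ D) P) (hK : Nat.card K = 2 * P) :
    ∃ e : (PSL(2, K) ⧸ D) ≃ WBSPoint K,
      (∀ u, (e u).1 = MulAction.stabilizer PSL(2, K) u) ∧
      IsSpaceIso (lsLines PSL(2, K) (PSL(2, K) ⧸ D)) (wbsLines K) e := by
  have hpt (u : PSL(2, K) ⧸ D) : Nonempty (MulAction.stabilizer PSL(2, K) u ≃*
      DihedralGroup (Nat.card K + 1)) := hK ▸ h.stabilizer_equiv u
  let e₀ : (PSL(2, K) ⧸ D) → WBSPoint K := fun u => ⟨MulAction.stabilizer PSL(2, K) u, hpt u⟩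
  have hbij : Function.Bijective e₀ := by
    constructor
    · intro u v huv
      exact h.stabilizer_injective (congrArg Subtype.val huv)
    · rintro ⟨D', ⟨e'⟩⟩
      obtain ⟨u⟩ := h.nonempty
      obtain ⟨e⟩ := h.stabilizer_equiv u
      obtain ⟨g, hg⟩ := h.tori.exists_conj_eq h.prime (by have := h.two_le; omega) e (hK ▸ e')
      refine ⟨g • u, Subtype.ext ?_⟩
      exact (MulAction.stabilizer_smul_eq_stabilizer_map_conj g u).trans hg
  let e := Equiv.ofBijective e₀ hbij
  have himg (t : PSL(2, K)) : e '' MulAction.fixedBy _ t = {D | t ∈ D.1} := by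
    ext D'
    obtain ⟨u, rfl⟩ := e.surjective D'
    rw [e.injective.mem_set_image]
    rfl
  refine ⟨e, fun u => rfl, fun l => ?_⟩
  rw [h.mem_lsLines_iff]
  constructor
  · rintro ⟨t, ht, hl⟩
    refine ⟨t, ht, e.injective.image_injective ?_⟩
    rw [hl, himg]
  · rintro ⟨t, ht, rfl⟩
    exact ⟨t, ht, himg t⟩

end IsTorusAction

/-- A space whose number of points is divisible by twice the common size `k` of its lines is not a
Witt–Bose–Shrikhande space. Otherwise the number `i` of involutions of `PSL₂(2 ^ n)` would satisfy
`i k = v (2 ^ n + 1)` and hence be even, but a finite group of even order has an odd number of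
involutions. -/
theorem not_isSpaceIso_wbs {X : Type*} {L : Set (Set X)} {v k : ℕ}
    (hv : Nat.card X = v) (hv0 : 0 < v) (hk : ∀ m ∈ L, m.ncard = k) (hkv : 2 * k ∣ v)
    {n : ℕ} (hn : 1 ≤ n) (e : X ≃ WBSPoint (GaloisField 2 n)) :
    ¬ IsSpaceIso L (wbsLines (GaloisField 2 n)) e := by
  intro he
  have hcard : Nat.card (GaloisField 2 n) = 2 ^ n := GaloisField.card 2 n (by omega)
  have heven : Even (Nat.card (GaloisField 2 n)) := by
    rw [hcard]
    exact (Nat.even_pow.2 ⟨even_two, by omega⟩)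
  have : Finite (GaloisField 2 n) := Nat.finite_of_card_ne_zero (by rw [hcard]; positivity)
  have : Finite PSL(2, GaloisField 2 n) := inferInstance
  have hk' : ∀ l ∈ wbsLines (GaloisField 2 n), l.ncard = k := by
    intro l hl
    rw [← e.image_preimage l] at hl ⊢
    rw [Set.ncard_image_of_injective _ e.injective]
    exact hk _ ((he _).1 hl)
  have h1 := wbs_count (GaloisField 2 n) heven hk'
  rw [← Nat.card_congr e, hv] at h1
  have hodd : Odd {g : PSL(2, GaloisField 2 n) | orderOf g = 2}.ncard := by
    apply odd_ncard_orderOf_eq_two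
    have : Nonempty X := (Nat.card_pos_iff.1 (hv ▸ hv0)).1
    obtain ⟨D, ⟨eD⟩⟩ := e this.some
    have := card_of_dihedral eD
    exact (even_two_mul _).trans_dvd (this ▸ Subgroup.card_subgroup_dvd_card D)
  obtain ⟨c, rfl⟩ := hkv
  have hk0 : 0 < k := by
    by_contra! h0
    simp [Nat.le_zero.1 h0] at hv0
  have h2 : {g : PSL(2, GaloisField 2 n) | orderOf g = 2}.ncard =
      2 * (c * (Nat.card (GaloisField 2 n) + 1)) := by
    apply Nat.eq_of_mul_eq_mul_right hk0
    rw [h1]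
    ring
  rw [h2] at hodd
  exact Nat.not_odd_iff_even.2 (even_two_mul _) hodd

theorem mainTheorem12 :
    -- `G = PSL₂(2^16)` is simple, so that it is its own (classical) socle
    IsSimpleGroup PSL(2, GaloisField 2 16) ∧
    -- the group `PSL₂(2^16)` does have dihedral subgroups of order `2q`, where `q = 65537`
    (∃ D : Subgroup PSL(2, GaloisField 2 16), Nonempty (D ≃* DihedralGroup 65537)) ∧
    -- there is a subgroup `C_1057 ⋊ C_3` of `ΓL₁(2^15)` as required
    (∃ H : Subgroup (Equiv.Perm (GaloisField 2 15)), IsSemilinearProduct H 1057 3) ∧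
    ∀ D : Subgroup PSL(2, GaloisField 2 16), Nonempty (D ≃* DihedralGroup 65537) →
      -- the action of `G` on the cosets of `D`
      Nat.card (PSL(2, GaloisField 2 16) ⧸ D) = 2 ^ 15 * (2 ^ 16 - 1) ∧
      IsExtremelyPrimitive PSL(2, GaloisField 2 16) (PSL(2, GaloisField 2 16) ⧸ D) ∧
      PropertyStar PSL(2, GaloisField 2 16) (PSL(2, GaloisField 2 16) ⧸ D) ∧
      -- the space `S = LS(G)`, which is the Witt–Bose–Shrikhande space
      IsLinearSpace (lsLines PSL(2, GaloisField 2 16) (PSL(2, GaloisField 2 16) ⧸ D)) ∧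
      ActsOnSpace PSL(2, GaloisField 2 16)
        (lsLines PSL(2, GaloisField 2 16) (PSL(2, GaloisField 2 16) ⧸ D)) ∧
      IsLineTransitive PSL(2, GaloisField 2 16)
        (lsLines PSL(2, GaloisField 2 16) (PSL(2, GaloisField 2 16) ⧸ D)) ∧
      IsTransverse PSL(2, GaloisField 2 16)
        (lsLines PSL(2, GaloisField 2 16) (PSL(2, GaloisField 2 16) ⧸ D)) ∧
      (∃ e : (PSL(2, GaloisField 2 16) ⧸ D) ≃ WBSPoint (GaloisField 2 16),
        (∀ u, (e u).1 = MulAction.stabilizer PSL(2, GaloisField 2 16) u) ∧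
        IsSpaceIso (lsLines PSL(2, GaloisField 2 16) (PSL(2, GaloisField 2 16) ⧸ D))
          (wbsLines (GaloisField 2 16)) e) ∧
      -- the lines of `S`
      (∀ l ∈ lsLines PSL(2, GaloisField 2 16) (PSL(2, GaloisField 2 16) ⧸ D),
        l.ncard = 2 ^ 15 ∧
        IsRegularPermGroup (inducedGroup PSL(2, GaloisField 2 16) l) ∧
        Nonempty (inducedGroup PSL(2, GaloisField 2 16) l ≃*
          Multiplicative (Fin 15 → ZMod 2)) ∧
        ∃ f : l ≃ GaloisField 2 15,
          (inducedGroup PSL(2, GaloisField 2 16) l).map f.permCongrHom.toMonoidHom =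
            translations (GaloisField 2 15)) ∧
      ∀ H : Subgroup (Equiv.Perm (GaloisField 2 15)), IsSemilinearProduct H 1057 3 →
        -- the group `A = V ⋊ H` and the space `T = LS(A)`
        PropertyStar (affineGroup H) (GaloisField 2 15) ∧
        IsLinearSpace (lsLines (affineGroup H) (GaloisField 2 15)) ∧
        affineGroup H ≤ autGroup (lsLines (affineGroup H) (GaloisField 2 15)) ∧
        (∀ t ∈ lsLines (affineGroup H) (GaloisField 2 15), t.ncard = 32) ∧
        -- the space `R`, for every line `l` of `S` and every identification `f` of `l` with the
        -- field of order `2^15` that turns `G_l^l` into the translation group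
        ∀ l ∈ lsLines PSL(2, GaloisField 2 16) (PSL(2, GaloisField 2 16) ⧸ D),
        ∀ f : l ≃ GaloisField 2 15,
          (inducedGroup PSL(2, GaloisField 2 16) l).map f.permCongrHom.toMonoidHom =
            translations (GaloisField 2 15) →
        ∀ R : Set (Set (PSL(2, GaloisField 2 16) ⧸ D)),
          R = constructionLines PSL(2, GaloisField 2 16) l
            {t : Set l | f '' t ∈ lsLines (affineGroup H) (GaloisField 2 15)} →
          IsLinearSpace R ∧
          IsNontrivialSpace R ∧
          ActsOnSpace PSL(2, GaloisField 2 16) R ∧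
          -- `R` refines `S`, is not equal to it, and is not a Witt–Bose–Shrikhande space at all
          IsRefinement R (lsLines PSL(2, GaloisField 2 16) (PSL(2, GaloisField 2 16) ⧸ D)) ∧
          R ≠ lsLines PSL(2, GaloisField 2 16) (PSL(2, GaloisField 2 16) ⧸ D) ∧
          (∀ n : ℕ, 1 ≤ n → ¬ ∃ e : (PSL(2, GaloisField 2 16) ⧸ D) ≃ WBSPoint (GaloisField 2 n),
            IsSpaceIso R (wbsLines (GaloisField 2 n)) e) ∧
          -- the parameters `k` and `r`
          (∀ m ∈ R, m.ncard = 32) ∧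
          (∀ u, {m ∈ R | u ∈ m}.ncard = 1057 * 65537) ∧
          -- transversality and the orbits of `G_u` on the lines through `u`
          IsTransverse PSL(2, GaloisField 2 16) R ∧
          (∀ m ∈ R, ∀ u ∈ m,
            (MulAction.orbit (MulAction.stabilizer PSL(2, GaloisField 2 16) u) m).ncard = 65537) ∧
          (∀ u, {o : Set (Set (PSL(2, GaloisField 2 16) ⧸ D)) | ∃ m ∈ R, u ∈ m ∧
            o = MulAction.orbit (MulAction.stabilizer PSL(2, GaloisField 2 16) u) m}.ncard
              = 1057) ∧
          -- `G` is not transitive on the lines of `R`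
          Nat.card PSL(2, GaloisField 2 16) < R.ncard ∧
          ¬ IsLineTransitive PSL(2, GaloisField 2 16) R := by
  have hcard : Nat.card (GaloisField 2 16) = 2 * 32768 := GaloisField.card 2 16 (by norm_num)
  have hF : Nat.card (GaloisField 2 15) = 2 ^ 15 := GaloisField.card 2 15 (by norm_num)
  have hfin : Finite (GaloisField 2 16) := Nat.finite_of_card_ne_zero (by rw [hcard]; norm_num)
  have hfinF : Finite (GaloisField 2 15) := finite_of_card hF
  have hq : Nat.Prime (2 * 32768 + 1) := by norm_num
  have hG : HasEllipticTori PSL(2, GaloisField 2 16) (2 * 32768) :=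
    hcard ▸ HasEllipticTori.projectiveSpecialLinearGroup (GaloisField 2 16)
  refine ⟨Matrix.ProjectiveSpecialLinearGroup.rank_two_simple (by rw [hcard]; norm_num),
    hG.exists_dihedral hq (by norm_num), ⟨_, isSemilinearProduct_normOneGroup hF⟩, ?_⟩
  rintro D ⟨eD⟩
  have h : IsTorusAction PSL(2, GaloisField 2 16) (PSL(2, GaloisField 2 16) ⧸ D) 32768 :=
    hG.isTorusAction hq (by norm_num) eD
  have hfinG := h.finite_group
  have hfinX := h.finite
  -- `2147450880 = 2 ^ 15 * (2 ^ 16 - 1)`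
  have hX : Nat.card (PSL(2, GaloisField 2 16) ⧸ D) = 2147450880 := h.card_eq
  refine ⟨hX, h.isExtremelyPrimitive, h.propertyStar, h.isLinearSpace, actsOnSpace_lsLines,
    h.isLineTransitive, h.isTransverse, h.exists_wbs_equiv hcard, fun l hl =>
    ⟨h.ncard_line hl, h.isRegularPermGroup_inducedGroup hl,
      h.nonempty_inducedGroup_mulEquiv hl (fun x => ?_) ?_,
      h.exists_equiv_map_inducedGroup hl hF⟩, fun H hH => ?_⟩
  · funext i
    exact ZModModule.char_nsmul_eq_zero 2 (x i)
  · simp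
  obtain rfl := hH.eq_normOneGroup hF
  have hT : IsLinearSpace (lsLines (affineGroup (normOneGroup hF)) (GaloisField 2 15)) :=
    (propertyStar_affineGroup hF).isLinearSpace
  refine ⟨propertyStar_affineGroup hF, hT, le_autGroup_lsLines _,
    fun t ht => ncard_of_mem_lsLines hF ht, ?_⟩
  rintro l hl f hf R rfl
  have hk : ∀ m ∈ constructionLines PSL(2, GaloisField 2 16) l
      {t : Set l | f '' t ∈ lsLines (affineGroup (normOneGroup hF)) (GaloisField 2 15)},
      m.ncard = 32 := by
    intro m hm
    refine ncard_constructionLines (fun t ht => ?_) hm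
    rw [← Set.ncard_image_of_injective t f.injective]
    exact ncard_of_mem_lsLines hF ht
  have hlin := h.isLinearSpace_constructionLines hl (hT.preimage f)
    (image_mem_of_mem_translations hf)
  have hact : ActsOnSpace PSL(2, GaloisField 2 16) (constructionLines PSL(2, GaloisField 2 16) l
      {t : Set l | f '' t ∈ lsLines (affineGroup (normOneGroup hF)) (GaloisField 2 15)}) :=
    actsOnSpace_iff.2 fun g m hm => smul_mem_constructionLines g hm
  have href := isRefinement_constructionLines (G := PSL(2, GaloisField 2 16)) hl
    {t : Set l | f '' t ∈ lsLines (affineGroup (normOneGroup hF)) (GaloisField 2 15)}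
  generalize constructionLines PSL(2, GaloisField 2 16) l
      {t : Set l | f '' t ∈ lsLines (affineGroup (normOneGroup hF)) (GaloisField 2 15)} = R at *
  have hnt : ∀ m ∈ R, m.Nontrivial := fun m hm => by
    rw [← Set.one_lt_ncard_iff_nontrivial, hk m hm]
    norm_num
  have hr (u) : {m ∈ R | u ∈ m}.ncard = 1057 * 65537 := by
    have := hlin.ncard_lines_through_mul (k := 31) hk u
    rw [hX] at this
    omega
  have hb : R.ncard * 32 = 2147450880 * (1057 * 65537) := by
    rw [ncard_mul_of_ncard_eq hk hr, hX]
  -- `281474976645120 = 2 ^ 16 * (2 ^ 32 - 1)`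
  have hPSL : Nat.card PSL(2, GaloisField 2 16) = 281474976645120 := hG.card_eq
  have hlt : Nat.card PSL(2, GaloisField 2 16) < R.ncard := by
    rw [hPSL]
    omega
  refine ⟨hlin, ⟨?_, fun m hm => ?_⟩, hact, href, ?_, ?_, hk, hr, href.isTransverse h.isTransverse,
    fun m hm u hu => h.ncard_orbit_line href hnt hm hu, fun u => ?_, hlt,
    fun htr => (htr.ncard_le.trans_lt hlt).false⟩
  · rw [← Set.one_lt_ncard_iff_nontrivial]
    omega
  · rw [← (Set.toFinite m).cast_ncard_eq, hk m hm]
    norm_num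
  · rintro rfl
    have := (hk l hl).symm.trans (h.ncard_line hl)
    omega
  · rintro n hn ⟨e, he⟩
    exact not_isSpaceIso_wbs hX (by norm_num) hk (by norm_num) hn e he
  · have := h.ncard_orbits_mul href hnt hact u
    rw [hr] at this
    exact Nat.eq_of_mul_eq_mul_right (by norm_num) this
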